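/- Let $W=(W(t))_{t\ge 0}$ be a standard one-dimensional Brownian motion on a probability space $(\Omega,P)$. For a probability measure $\theta$ on $[0,1]$ let $\mu$ be the image of $\theta$ under $W$, i.e. the random probability measure on $\mathbb R$ with $\int f\,d\mu=\int_0^1 f(W(t))\,d\theta(t)$. Write $$\widehat\mu(\xi)=\int e^{-2\pi i\xi x}\,d\mu(x),\qquad \Lambda(\mu,\mu,\mu)=\int_{\mathbb R}\widehat\mu(\xi)^2\,\widehat\mu(-2\xi)\,d\xi .$$ For every $C_0>0$ and every $\varepsilon>0$ there is a constant $c>0$, depending only on $C_0$ and $\varepsilon$, such that the following holds. Let $\alpha\in(0,1)$ with $\alpha>\frac23+\varepsilon$, and let $\theta$ be a probability measure on $[0,1]$ with $\theta(I)\le C_0|I|^{\alpha/2}$ for every interval $I$. Then almost surely the integral defining $\Lambda(\mu,\mu,\mu)$ converges absolutely, the event $\{\Lambda(\mu,\mu,\mu)>0\}$ is measurable up to a null set, and $$P\bigl(\Lambda(\mu,\mu,\mu)>0\bigr)\ \ge\ c .$$ Moreover, there is an event of probability at least $c$ on which the support $E$ of $\mu$ contains a non-trivial 3-term arithmetic progression: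 there are $x,y\in E$ with $x\ne y$ and $\frac{x+y}2\in E$. -/

import Mathlib

open MeasureTheory ProbabilityTheory
open scoped NNReal ComplexOrder

namespace BrownianAP

/-- `θ` is a probability measure carried by `[0, 1]` with `θ(I) ≤ C |I| ^ s` for every
(closed bounded, possibly degenerate) interval `I`. -/
structure IsFrostman (θ : Measure ℝ) (s C : ℝ) : Prop where
  isProbabilityMeasure : IsProbabilityMeasure θ
  compl_Icc : θ (Set.Icc 0 1)ᶜ = 0
  measure_Icc_le : ∀ a b : ℝ, a ≤ b → θ.real (Set.Icc a b) ≤ C * (b - a) ^ s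

/-- The random measure `μ` with `∫ f dμ = ∫ f (W t) dθ(t)`: the image of `θ`
(a measure on the time axis carried by `[0, 1]`) under the path `t ↦ W t ω`. -/
noncomputable def pathImage {Ω : Type*} (θ : Measure ℝ) (W : ℝ≥0 → Ω → ℝ) (ω : Ω) : Measure ℝ :=
  θ.map (fun t : ℝ ↦ W t.toNNReal ω)

/-- The Fourier transform `∫ exp (-2πiξx) dμ(x)` of a measure on the line. -/
noncomputable def fourierMeasure (μ : Measure ℝ) (ξ : ℝ) : ℂ :=
  ∫ x : ℝ, Complex.exp (-2 * Real.pi * Complex.I * ξ * x) ∂μ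

/-- The integrand of the trilinear form `Lambda`. -/
noncomputable def lambdaIntegrand (μ₁ μ₂ μ₃ : Measure ℝ) (ξ : ℝ) : ℂ :=
  fourierMeasure μ₁ ξ * fourierMeasure μ₂ ξ * fourierMeasure μ₃ (-2 * ξ)

/-- The trilinear form `Λ(μ₁, μ₂, μ₃)`, an integral over the line. -/
noncomputable def Lambda (μ₁ μ₂ μ₃ : Measure ℝ) : ℂ :=
  ∫ ξ : ℝ, lambdaIntegrand μ₁ μ₂ μ₃ ξ

/-- `E` contains a nontrivial three-term arithmetic progression `x, (x + y) / 2, y`. -/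
def HasThreeAP (E : Set ℝ) : Prop :=
  ∃ x ∈ E, ∃ y ∈ E, x ≠ y ∧ (x + y) / 2 ∈ E

end BrownianAP

/-!
The idea is a second moment argument, applied to a variant of `Λ` that does not see the trivial
progressions.

Let `φ(ξ)` be the Fourier transform of `μ`. Expanding `‖φ(ξ)‖⁶` gives an average over six times of
a Gaussian characteristic function, whose exponent is the variance of a sum of six values of `W` with
signs. When the times are put in order, this variance is at least the sum of the first, third and
fifth gaps between neighbours (`exists_pairing_le_brownianForm`), so the average is at most a
constant times the cube of the two-point energy `∬ exp (-2π²ξ²|t - t'|)`, and the Frostman condition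
yields `E ‖φ(ξ)‖⁶ ≲ |ξ| ^ (-3α)` for `|ξ| ≥ 1`
(`integral_norm_pathFourier_pow_six_le`). The integrand of `Λ` is at most
`‖φ(ξ)‖³ + ‖φ(-2ξ)‖³`, and since `3α > 2 + 3ε`, Cauchy–Schwarz with a power weight bounds
the second moment of its `L¹` norm by a constant depending on `C₀` and `ε` only
(`lintegral_sq_lintegral_pathIntegrand_le`). In particular `Λ` converges absolutely almost surely.

For small `b > 0` consider the average `dampedForm` over triples of times of
`k_b(x + y - 2z) (1 - cos (2πκ(x - y)))`, where `x, y, z` are the values of `W` and `k_b` is a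
Gaussian approximate identity. It is nonnegative and at most twice the smoothed form `smoothForm`,
which is dominated by the `L¹` norm above and tends to `Λ` as `b → 0`. Its expectation is a
combination of explicit Gaussian integrals. Restricted to the times with mutual distances at least
`r`, which have mass at least `1 / 2` when `r` is small in terms of `C₀`, the contribution of the
cosine is negligible once `κ` is large, so the expectation is bounded below by an absolute constant
(`le_integral_dampedForm`). The Paley–Zygmund inequality bounds below the probability that the damped
form exceeds a fixed threshold, for every `b`, and hence the probability that it does so for
infinitely many of the values `b = 1 / (n + 1)`.

On that event `Λ`, which is real by symmetry, is positive. Moreover the support contains a nontrivial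
progression: otherwise, by compactness, the damped forms would tend to `0`
(`exists_progression_of_frequently_lt_dampedForm`).
-/

namespace BrownianAP

/-! ### The covariance form of Brownian motion -/

/-- The variance of `∑ i, a i * W (t i)` for a Brownian motion `W`, as a quadratic form in `a`. -/
noncomputable def brownianForm {ι : Type*} [Fintype ι] (a : ι → ℝ) (t : ι → ℝ≥0) : ℝ :=
  ∑ i, ∑ j, a i * a j * min (t i : ℝ) (t j)

theorem brownianForm_comp_equiv {ι κ : Type*} [Fintype ι] [Fintype κ] (e : κ ≃ ι)
    (a : ι → ℝ) (t : ι → ℝ≥0) :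
    brownianForm (a ∘ e) (t ∘ e) = brownianForm a t := by
  unfold brownianForm
  rw [← e.sum_comp]
  refine Finset.sum_congr rfl fun i _ ↦ ?_
  rw [← e.sum_comp]
  rfl

theorem brownianForm_const_mul {ι : Type*} [Fintype ι] (c : ℝ) (a : ι → ℝ) (t : ι → ℝ≥0) :
    brownianForm (fun i ↦ c * a i) t = c ^ 2 * brownianForm a t := by
  unfold brownianForm
  simp_rw [Finset.mul_sum]
  refine Finset.sum_congr rfl fun i _ ↦ Finset.sum_congr rfl fun j _ ↦ ?_
  ring

section Gaussian

variable {Ω : Type*} {mΩ : MeasurableSpace Ω} {P : Measure Ω} {W : ℝ≥0 → Ω → ℝ}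

theorem integral_cexp_sum_mul {ι : Type*} [Fintype ι]
    (hW : IsPreBrownianReal W P) (a : ι → ℝ) (t : ι → ℝ≥0) :
    ∫ ω, Complex.exp (((∑ i, a i * W (t i) ω : ℝ) : ℂ) * Complex.I) ∂P
      = (Real.exp (-(brownianForm a t / 2)) : ℝ) := by
  have := hW.isGaussianProcess.isProbabilityMeasure
  have hG : IsGaussianProcess (fun i ω ↦ a i * W (t i) ω) P :=
    (hW.isGaussianProcess.comp_right t).smul a
  have hL : HasGaussianLaw (fun ω ↦ ∑ i, a i * W (t i) ω) P :=
    hG.hasGaussianLaw_fun_sum (I := Finset.univ)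
  have h2 (i : ι) : MemLp (fun ω ↦ a i * W (t i) ω) 2 P := (hG.hasGaussianLaw_eval i).memLp_two
  have hvar : Var[fun ω ↦ ∑ i, a i * W (t i) ω; P] = brownianForm a t := by
    rw [variance_fun_sum h2]
    unfold brownianForm
    refine Finset.sum_congr rfl fun i _ ↦ Finset.sum_congr rfl fun j _ ↦ ?_
    rw [covariance_const_mul_left, covariance_const_mul_right, hW.covariance_fun_eval]
    push_cast
    ring
  have hmean : ∫ ω, ∑ i, a i * W (t i) ω ∂P = 0 := by
    rw [integral_finsetSum _ fun i _ ↦ (h2 i).integrable (by norm_num)]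
    refine Finset.sum_eq_zero fun i _ ↦ ?_
    rw [integral_const_mul, hW.integral_eval, mul_zero]
  have h := hL.charFun_map_eq (1 : ℝ)
  rw [charFun_apply, integral_map hL.aemeasurable (by fun_prop)] at h
  simp only [RCLike.inner_apply, conj_trivial, one_mul, mul_one] at h
  rw [h, hmean, hvar]
  push_cast
  congr 1
  simp

theorem integral_cos_sum_mul {ι : Type*} [Fintype ι]
    (hW : IsPreBrownianReal W P) (a : ι → ℝ) (t : ι → ℝ≥0) :
    ∫ ω, Real.cos (∑ i, a i * W (t i) ω) ∂P = Real.exp (-(brownianForm a t / 2)) := by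
  have := hW.isGaussianProcess.isProbabilityMeasure
  have h := congrArg Complex.re (integral_cexp_sum_mul hW a t)
  rw [Complex.ofReal_re] at h
  rw [← h, ← RCLike.re_eq_complex_re, ← integral_re]
  · refine integral_congr_ae (ae_of_all _ fun ω ↦ ?_)
    simp only [RCLike.re_eq_complex_re, Complex.exp_ofReal_mul_I_re]
  · refine Integrable.of_bound (C := 1) ?_ (ae_of_all _ fun ω ↦ ?_)
    · have hm := fun i ↦ hW.aemeasurable (t i)
      exact AEMeasurable.aestronglyMeasurable (by fun_prop)
    · rw [Complex.norm_exp_ofReal_mul_I]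

end Gaussian

/-- For ordered times the variance of a signed sum is the sum over the gaps of the squared tail
sums of the signs. The tail sums with an odd number of terms are odd integers, so every second gap
enters with a factor at least `1`. -/
theorem pairing_le_brownianForm_of_monotone (a : Fin 6 → ℝ) (ha : ∀ i, a i = 1 ∨ a i = -1)
    (t : Fin 6 → ℝ≥0) (ht : Monotone t) :
    ((t 1 : ℝ) - t 0) + (t 3 - t 2) + (t 5 - t 4) ≤ brownianForm a t := by
  have h01 : (t 0 : ℝ) ≤ t 1 := by exact_mod_cast ht (by decide)
  have h12 : (t 1 : ℝ) ≤ t 2 := by exact_mod_cast ht (by decide)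
  have h23 : (t 2 : ℝ) ≤ t 3 := by exact_mod_cast ht (by decide)
  have h34 : (t 3 : ℝ) ≤ t 4 := by exact_mod_cast ht (by decide)
  have h45 : (t 4 : ℝ) ≤ t 5 := by exact_mod_cast ht (by decide)
  have h0 : (0 : ℝ) ≤ t 0 := (t 0).2
  have hmin (i j : Fin 6) : min (t i : ℝ) (t j) = (t (min i j) : ℝ) := by
    rw [← NNReal.coe_min, ht.map_min]
  have key : brownianForm a t = (t 0 : ℝ) * (a 0 + a 1 + a 2 + a 3 + a 4 + a 5) ^ 2
      + (t 1 - t 0) * (a 1 + a 2 + a 3 + a 4 + a 5) ^ 2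
      + (t 2 - t 1) * (a 2 + a 3 + a 4 + a 5) ^ 2 + (t 3 - t 2) * (a 3 + a 4 + a 5) ^ 2
      + (t 4 - t 3) * (a 4 + a 5) ^ 2 + (t 5 - t 4) * (a 5) ^ 2 := by
    unfold brownianForm
    simp_rw [hmin]
    simp only [Fin.sum_univ_six]
    have m (i j k : Fin 6) (h : min i j = k) : t (min i j) = t k := by rw [h]
    rw [m 0 0 0 rfl, m 0 1 0 rfl, m 0 2 0 rfl, m 0 3 0 rfl, m 0 4 0 rfl, m 0 5 0 rfl,
      m 1 0 0 rfl, m 1 1 1 rfl, m 1 2 1 rfl, m 1 3 1 rfl, m 1 4 1 rfl, m 1 5 1 rfl,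
      m 2 0 0 rfl, m 2 1 1 rfl, m 2 2 2 rfl, m 2 3 2 rfl, m 2 4 2 rfl, m 2 5 2 rfl,
      m 3 0 0 rfl, m 3 1 1 rfl, m 3 2 2 rfl, m 3 3 3 rfl, m 3 4 3 rfl, m 3 5 3 rfl,
      m 4 0 0 rfl, m 4 1 1 rfl, m 4 2 2 rfl, m 4 3 3 rfl, m 4 4 4 rfl, m 4 5 4 rfl,
      m 5 0 0 rfl, m 5 1 1 rfl, m 5 2 2 rfl, m 5 3 3 rfl, m 5 4 4 rfl, m 5 5 5 rfl]
    ring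
  have s5 : 1 ≤ a 5 ^ 2 := by rcases ha 5 with h | h <;> rw [h] <;> norm_num
  have s3 : 1 ≤ (a 3 + a 4 + a 5) ^ 2 := by
    rcases ha 3 with h3 | h3 <;> rcases ha 4 with h4 | h4 <;> rcases ha 5 with h5 | h5 <;>
      rw [h3, h4, h5] <;> norm_num
  have s1 : 1 ≤ (a 1 + a 2 + a 3 + a 4 + a 5) ^ 2 := by
    rcases ha 1 with h1 | h1 <;> rcases ha 2 with h2 | h2 <;>
    rcases ha 3 with h3 | h3 <;> rcases ha 4 with h4 | h4 <;> rcases ha 5 with h5 | h5 <;>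
      rw [h1, h2, h3, h4, h5] <;> norm_num
  rw [key]
  have e1 := le_mul_of_one_le_right (sub_nonneg.2 h01) s1
  have e3 := le_mul_of_one_le_right (sub_nonneg.2 h23) s3
  have e5 := le_mul_of_one_le_right (sub_nonneg.2 h45) s5
  have p0 := mul_nonneg h0 (sq_nonneg (a 0 + a 1 + a 2 + a 3 + a 4 + a 5))
  have p2 := mul_nonneg (sub_nonneg.2 h12) (sq_nonneg (a 2 + a 3 + a 4 + a 5))
  have p4 := mul_nonneg (sub_nonneg.2 h34) (sq_nonneg (a 4 + a 5))
  linarith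

/-- The pairing joins neighbours in the order of the times: `σ` sorts `t`. -/
theorem exists_pairing_le_brownianForm (a : Fin 6 → ℝ) (ha : ∀ i, a i = 1 ∨ a i = -1)
    (t : Fin 6 → ℝ≥0) : ∃ σ : Equiv.Perm (Fin 6),
      dist (t (σ 0)) (t (σ 1)) + dist (t (σ 2)) (t (σ 3)) + dist (t (σ 4)) (t (σ 5))
        ≤ brownianForm a t := by
  refine ⟨Tuple.sort t, ?_⟩
  have hm := Tuple.monotone_sort t
  have h := pairing_le_brownianForm_of_monotone (a ∘ Tuple.sort t) (fun i ↦ ha _) _ hm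
  rw [brownianForm_comp_equiv] at h
  refine le_trans (le_of_eq ?_) h
  have d (i j : Fin 6) (hij : i ≤ j) : dist (t (Tuple.sort t i)) (t (Tuple.sort t j))
      = ((t ∘ Tuple.sort t) j : ℝ) - (t ∘ Tuple.sort t) i := by
    have : (((t ∘ Tuple.sort t) i : ℝ≥0) : ℝ) ≤ (t ∘ Tuple.sort t) j := by exact_mod_cast hm hij
    rw [NNReal.dist_eq, abs_sub_comm, abs_of_nonneg]
    · rfl
    · exact sub_nonneg.2 this
  rw [d 0 1 (by decide), d 2 3 (by decide), d 4 5 (by decide)]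

/-- `W (t 0) + W (t 1) - 2 * W (t 2)` has variance at most `16`. -/
theorem brownianForm_fin_three_le {t : Fin 3 → ℝ≥0} (ht : ∀ i, t i ≤ 1) :
    brownianForm ![1, 1, -2] t ≤ 16 := by
  have h0 : (0 : ℝ) ≤ t 0 := (t 0).2
  have h1 : (0 : ℝ) ≤ t 1 := (t 1).2
  have h2 : (0 : ℝ) ≤ t 2 := (t 2).2
  have g0 : (t 0 : ℝ) ≤ 1 := by exact_mod_cast ht 0
  have g1 : (t 1 : ℝ) ≤ 1 := by exact_mod_cast ht 1
  have g2 : (t 2 : ℝ) ≤ 1 := by exact_mod_cast ht 2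
  simp only [brownianForm, Fin.sum_univ_three, Matrix.cons_val_zero, Matrix.cons_val_one,
    Matrix.cons_val, min_self]
  have a1 := min_le_left (t 0 : ℝ) (t 1)
  have a2 := min_le_left (t 1 : ℝ) (t 0)
  have b1 := le_min h0 h2
  have b2 := le_min h2 h0
  have b3 := le_min h1 h2
  have b4 := le_min h2 h1
  linarith

/-- If the coefficients sum to `0` only increments over the two gaps contribute, and each gap is at
least `r`. Applied to `(ξ + κ, ξ - κ, -2ξ)`, the lower bound grows with both `ξ` and `κ`. -/
theorem le_brownianForm_of_separated {t : Fin 3 → ℝ≥0} {r : ℝ} (hr : 0 ≤ r)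
    (ht : ∀ i j, i ≠ j → r ≤ dist (t i) (t j)) (a : Fin 3 → ℝ) (ha : a 0 + a 1 + a 2 = 0) :
    r / 3 * (a 0 ^ 2 + a 1 ^ 2 + a 2 ^ 2) ≤ brownianForm a t := by
  have g01 := ht 0 1 (by decide)
  have g02 := ht 0 2 (by decide)
  have g12 := ht 1 2 (by decide)
  have ha2 : a 2 = -a 0 - a 1 := by linarith
  simp only [brownianForm, Fin.sum_univ_three, min_self, ha2]
  generalize a 0 = x
  generalize a 1 = y
  rw [NNReal.dist_eq] at g01 g02 g12
  generalize (t 0 : ℝ) = u at *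
  generalize (t 1 : ℝ) = v at *
  generalize (t 2 : ℝ) = w at *
  have key (p q z1 z2 : ℝ) (hp : r ≤ p) (hq : r ≤ q) : r * z1 ^ 2 + r * z2 ^ 2 ≤
      p * z1 ^ 2 + q * z2 ^ 2 := by gcongr
  have k2 (z1 z2 : ℝ) : 0 ≤ r * (z1 - z2) ^ 2 := by positivity
  rcases le_total u v with h1 | h1 <;> rcases le_total u w with h2 | h2 <;>
    rcases le_total v w with h3 | h3 <;>
    simp only [min_eq_left h1, min_eq_right h1, min_eq_left h2, min_eq_right h2,
      min_eq_left h3, min_eq_right h3] <;>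
    (try rw [abs_of_nonneg (sub_nonneg.2 h1)] at g01) <;>
    (try rw [abs_of_nonpos (sub_nonpos.2 h1)] at g01) <;>
    (try rw [abs_of_nonneg (sub_nonneg.2 h2)] at g02) <;>
    (try rw [abs_of_nonpos (sub_nonpos.2 h2)] at g02) <;>
    (try rw [abs_of_nonneg (sub_nonneg.2 h3)] at g12) <;>
    (try rw [abs_of_nonpos (sub_nonpos.2 h3)] at g12)
  · nlinarith [key (v - u) (w - v) x (x+y) (by linarith) (by linarith), k2 x (-x-y)]
  · nlinarith [key (w - u) (v - w) x y (by linarith) (by linarith), k2 x y]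
  · nlinarith [key (w - u) (v - w) x y (by linarith) (by linarith), k2 x y]
  · nlinarith [key (u - w) (v - u) (x+y) y (by linarith) (by linarith), k2 (-x-y) y]
  · nlinarith [key (u - v) (w - u) y (x+y) (by linarith) (by linarith), k2 (-x-y) y]
  · nlinarith [key (u - v) (w - u) y (x+y) (by linarith) (by linarith), k2 (-x-y) y]
  · nlinarith [key (w - v) (u - w) y x (by linarith) (by linarith), k2 x y]
  · nlinarith [key (v - w) (u - v) (x+y) x (by linarith) (by linarith), k2 (-x-y) x]

/-! ### The sixth moment of the Fourier transform -/

section Energy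

/-- Disjoint pairs of coordinates of an i.i.d. sample are independent. -/
theorem integral_pi_prod_pairs {X : Type*} [MeasurableSpace X] (ν : Measure X)
    [IsProbabilityMeasure ν] {ι κ : Type*} [Fintype ι] [Fintype κ] (e : κ ⊕ κ ≃ ι)
    (f : X × X → ℝ) :
    ∫ t, ∏ k : κ, f (t (e (.inl k)), t (e (.inr k))) ∂(Measure.pi fun _ : ι ↦ ν)
      = (∫ p, f p ∂(ν.prod ν)) ^ Fintype.card κ := by
  have h1 := measurePreserving_arrowProdEquivProdArrow X X κ (fun _ ↦ ν) (fun _ ↦ ν)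
  have h2 := measurePreserving_sumPiEquivProdPi_symm (X := fun _ : κ ⊕ κ ↦ X) (fun _ ↦ ν)
  have h3 := measurePreserving_piCongrLeft (α := fun _ : ι ↦ X) (fun _ ↦ ν) e
  rw [← integral_fintype_prod_eq_pow, ← h3.integral_comp', ← h2.integral_comp',
    ← h1.integral_comp']
  refine integral_congr_ae (ae_of_all _ fun p ↦ Finset.prod_congr rfl fun k _ ↦ ?_)
  simp only [MeasurableEquiv.coe_piCongrLeft, Equiv.piCongrLeft_apply_apply]
  rfl

/-- Splitting six coordinates into three consecutive pairs. -/
def pairEquiv : Fin 3 ⊕ Fin 3 ≃ Fin 6 where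
  toFun := Sum.elim ![0, 2, 4] ![1, 3, 5]
  invFun := ![.inl 0, .inr 0, .inl 1, .inr 1, .inl 2, .inr 2]
  left_inv := by decide
  right_inv := by decide

variable (ν : Measure ℝ≥0) [IsProbabilityMeasure ν]

/-- Bounding `exp (-L * brownianForm a t)` by the sum over all `6!` pairings removes the ordering of
the times and leaves a product of three two-point energies. -/
theorem integral_exp_neg_brownianForm_le {L B : ℝ} (hL : 0 ≤ L)
    (hB : ∀ t, ∫ t', Real.exp (-(L * dist t t')) ∂ν ≤ B)
    (a : Fin 6 → ℝ) (ha : ∀ i, a i = 1 ∨ a i = -1) :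
    ∫ t, Real.exp (-(L * brownianForm a t)) ∂(Measure.pi fun _ ↦ ν) ≤ 720 * B ^ 3 := by
  have hint (σ : Equiv.Perm (Fin 6)) : Integrable (fun t : Fin 6 → ℝ≥0 ↦
      ∏ k : Fin 3, Real.exp (-(L * dist (t ((pairEquiv.trans σ) (.inl k)))
        (t ((pairEquiv.trans σ) (.inr k)))))) (Measure.pi fun _ ↦ ν) := by
    refine Integrable.of_bound (C := 1) (Continuous.aestronglyMeasurable (by fun_prop))
      (ae_of_all _ fun t ↦ ?_)
    rw [Real.norm_of_nonneg (by positivity)]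
    refine Finset.prod_le_one (fun _ _ ↦ by positivity) fun _ _ ↦ ?_
    rw [Real.exp_le_one_iff, neg_nonpos]
    positivity
  have hpair : ∫ p, Real.exp (-(L * dist p.1 p.2)) ∂(ν.prod ν) ≤ B := by
    rw [integral_prod]
    · refine (integral_mono_of_nonneg (ae_of_all _ fun _ ↦ by positivity)
        (integrable_const B) (ae_of_all _ hB)).trans ?_
      simp
    · refine Integrable.of_bound (C := 1) (Continuous.aestronglyMeasurable (by fun_prop))
        (ae_of_all _ fun t ↦ ?_)
      rw [Real.norm_of_nonneg (by positivity), Real.exp_le_one_iff, neg_nonpos]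
      positivity
  calc ∫ t, Real.exp (-(L * brownianForm a t)) ∂(Measure.pi fun _ ↦ ν)
      ≤ ∫ t, ∑ σ : Equiv.Perm (Fin 6),
        ∏ k : Fin 3, Real.exp (-(L * dist (t ((pairEquiv.trans σ) (.inl k)))
          (t ((pairEquiv.trans σ) (.inr k))))) ∂(Measure.pi fun _ ↦ ν) := by
        refine integral_mono_of_nonneg (ae_of_all _ fun _ ↦ by positivity)
          (integrable_finsetSum _ fun σ _ ↦ hint σ) (ae_of_all _ fun t ↦ ?_)
        obtain ⟨σ, hσ⟩ := exists_pairing_le_brownianForm a ha t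
        refine le_trans ?_ (Finset.single_le_sum (fun σ _ ↦ by positivity) (Finset.mem_univ σ))
        rw [← Real.exp_sum]
        refine Real.exp_le_exp.2 ?_
        rw [Fin.sum_univ_three]
        have := mul_le_mul_of_nonneg_left hσ hL
        simp only [pairEquiv, Equiv.trans_apply, Equiv.coe_fn_mk, Sum.elim_inl, Sum.elim_inr,
          Matrix.cons_val_zero, Matrix.cons_val_one, Matrix.cons_val]
        linarith
    _ = ∑ σ : Equiv.Perm (Fin 6), (∫ p, Real.exp (-(L * dist p.1 p.2)) ∂(ν.prod ν)) ^ 3 := by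
        rw [integral_finsetSum _ fun σ _ ↦ hint σ]
        refine Finset.sum_congr rfl fun σ _ ↦ ?_
        exact integral_pi_prod_pairs ν (pairEquiv.trans σ)
          (fun p : ℝ≥0 × ℝ≥0 ↦ Real.exp (-(L * dist p.1 p.2)))
    _ ≤ 720 * B ^ 3 := by
        rw [Finset.sum_const, Finset.card_univ, Fintype.card_perm, Fintype.card_fin, nsmul_eq_mul]
        norm_num [Nat.factorial]
        exact pow_le_pow_left₀ (integral_nonneg fun _ ↦ by positivity) hpair 3

/-- The constant `∑ exp (-k) (k + 1)` in the bound for the Laplace transform of a Frostman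
measure. -/
noncomputable def laplaceConst : ℝ := ∑' k : ℕ, Real.exp (-k) * (k + 1)

theorem summable_laplaceConst : Summable fun k : ℕ ↦ Real.exp (-k) * ((k : ℝ) + 1) := by
  have h1 := Real.summable_pow_mul_exp_neg_nat_mul 1 one_pos
  have h0 := Real.summable_pow_mul_exp_neg_nat_mul 0 one_pos
  refine (h1.add h0).congr fun k ↦ ?_
  simp
  ring

theorem laplaceConst_nonneg : 0 ≤ laplaceConst := tsum_nonneg fun k ↦ by positivity

/-- The kernel `exp (-L d)` is dominated by `∑ exp (-k)` times the indicators of the balls of radius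
`(k + 1) / L`, whose masses the Frostman condition bounds. -/
theorem integral_exp_neg_dist_le {s C L : ℝ} (hC : 0 ≤ C) (hs1 : s ≤ 1) (hL : 0 < L)
    (hν : ∀ (t : ℝ≥0) (ρ : ℝ), 0 ≤ ρ → ν.real (Metric.closedBall t ρ) ≤ C * (2 * ρ) ^ s)
    (t : ℝ≥0) :
    ∫ t', Real.exp (-(L * dist t t')) ∂ν ≤ laplaceConst * C * (2 / L) ^ s := by
  have hk (k : ℕ) : ν (Metric.closedBall t ((k + 1) / L))
      ≤ ENNReal.ofReal (C * (2 / L) ^ s * (k + 1)) := by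
    rw [← ofReal_measureReal]
    refine ENNReal.ofReal_le_ofReal ((hν t _ (by positivity)).trans ?_)
    rw [show 2 * (((k : ℝ) + 1) / L) = 2 / L * (k + 1) by ring,
      Real.mul_rpow (by positivity) (by positivity), ← mul_assoc]
    gcongr
    exact (Real.rpow_le_rpow_of_exponent_le (by linarith [k.cast_nonneg (α := ℝ)]) hs1).trans_eq
      (Real.rpow_one _)
  rw [integral_eq_lintegral_of_nonneg_ae (ae_of_all _ fun _ ↦ by positivity)
    (Continuous.aestronglyMeasurable (by fun_prop))]
  refine ENNReal.toReal_le_of_le_ofReal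
    (mul_nonneg (mul_nonneg laplaceConst_nonneg hC) (by positivity)) ?_
  calc ∫⁻ t', ENNReal.ofReal (Real.exp (-(L * dist t t'))) ∂ν
      ≤ ∫⁻ t', ∑' k : ℕ, (Metric.closedBall t ((k + 1) / L)).indicator
          (fun _ ↦ ENNReal.ofReal (Real.exp (-k))) t' ∂ν := by
        refine lintegral_mono fun t' ↦ ?_
        refine le_trans ?_ (ENNReal.le_tsum ⌊L * dist t t'⌋₊)
        rw [Set.indicator_of_mem]
        · refine ENNReal.ofReal_le_ofReal (Real.exp_le_exp.2 (neg_le_neg ?_))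
          exact Nat.floor_le (by positivity)
        · rw [Metric.mem_closedBall', le_div_iff₀ hL, mul_comm]
          exact (Nat.lt_floor_add_one _).le
    _ = ∑' k : ℕ, ENNReal.ofReal (Real.exp (-k)) * ν (Metric.closedBall t ((k + 1) / L)) := by
        rw [lintegral_tsum fun k ↦
          (measurable_const.indicator Metric.isClosed_closedBall.measurableSet).aemeasurable]
        refine tsum_congr fun k ↦ ?_
        rw [lintegral_indicator_const Metric.isClosed_closedBall.measurableSet]
    _ ≤ ∑' k : ℕ, ENNReal.ofReal (Real.exp (-k) * (k + 1) * (C * (2 / L) ^ s)) := by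
        refine ENNReal.tsum_le_tsum fun k ↦ ?_
        refine (mul_le_mul_right (hk k) _).trans_eq ?_
        rw [← ENNReal.ofReal_mul (by positivity)]
        ring_nf
    _ = ENNReal.ofReal (laplaceConst * C * (2 / L) ^ s) := by
        rw [← ENNReal.ofReal_tsum_of_nonneg (fun k ↦ by positivity)
          (summable_laplaceConst.mul_right _), tsum_mul_right, mul_assoc]
        rfl

end Energy

section Fourier

variable {Ω : Type*} {mΩ : MeasurableSpace Ω} {P : Measure Ω} {W : ℝ≥0 → Ω → ℝ}
  (ν : Measure ℝ≥0)

/-- The Fourier transform of the image of `ν` under the path `W · ω`. -/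
noncomputable def pathFourier (ν : Measure ℝ≥0) (W : ℝ≥0 → Ω → ℝ) (ω : Ω) (ξ : ℝ) : ℂ :=
  ∫ t, Complex.exp (((-2 * Real.pi * ξ) * W t ω : ℝ) * Complex.I) ∂ν

theorem norm_pathFourier_le_one [IsProbabilityMeasure ν] (ω : Ω) (ξ : ℝ) :
    ‖pathFourier ν W ω ξ‖ ≤ 1 := by
  refine (norm_integral_le_of_norm_le_const (C := 1) (ae_of_all _ fun t ↦ ?_)).trans (by simp)
  rw [Complex.norm_exp_ofReal_mul_I]

theorem pathFourier_neg (ω : Ω) (ξ : ℝ) :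
    pathFourier ν W ω (-ξ) = starRingEnd ℂ (pathFourier ν W ω ξ) := by
  unfold pathFourier
  rw [← integral_conj]
  refine integral_congr_ae (ae_of_all _ fun t ↦ ?_)
  simp only
  rw [← Complex.exp_conj]
  rw [map_mul, Complex.conj_ofReal, Complex.conj_I]
  push_cast
  ring_nf

theorem prod_pathFourier [SigmaFinite ν] {ι : Type*} [Fintype ι] (ω : Ω) (a : ι → ℝ) :
    ∏ i, pathFourier ν W ω (a i) = ∫ t, Complex.exp
      (((∑ i, (-2 * Real.pi * a i) * W (t i) ω : ℝ) : ℂ) * Complex.I)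
        ∂(Measure.pi fun _ : ι ↦ ν) := by
  unfold pathFourier
  rw [← integral_fintype_prod_eq_prod
    (f := fun i (t : ℝ≥0) ↦ Complex.exp (((-2 * Real.pi * a i) * W t ω : ℝ) * Complex.I))]
  refine integral_congr_ae (ae_of_all _ fun t ↦ ?_)
  simp only
  rw [← Complex.exp_sum]
  congr 1
  push_cast
  rw [Finset.sum_mul]

theorem integral_prod_pathFourier [IsProbabilityMeasure ν] (hW : IsPreBrownianReal W P)
    (hm : Measurable (Function.uncurry W)) {ι : Type*} [Fintype ι] (a : ι → ℝ) :
    ∫ ω, ∏ i, pathFourier ν W ω (a i) ∂P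
      = (∫ t, Real.exp (-(2 * Real.pi ^ 2 * brownianForm a t)) ∂(Measure.pi fun _ : ι ↦ ν) :
          ℝ) := by
  have := hW.isGaussianProcess.isProbabilityMeasure
  simp_rw [prod_pathFourier]
  rw [integral_integral_swap, ← integral_complex_ofReal]
  · refine integral_congr_ae (ae_of_all _ fun t ↦ ?_)
    simp only
    rw [integral_cexp_sum_mul hW, brownianForm_const_mul]
    congr 2
    ring
  · refine Integrable.of_bound (C := 1) ?_ (ae_of_all _ fun p ↦ ?_)
    · refine Measurable.aestronglyMeasurable ?_
      have h (i : ι) : Measurable fun p : Ω × (ι → ℝ≥0) ↦ W (p.2 i) p.1 :=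
        hm.comp (f := fun p : Ω × (ι → ℝ≥0) ↦ (p.2 i, p.1)) (by fun_prop)
      simp only [Function.uncurry_def]
      fun_prop
    · simp only [Function.uncurry_def]
      rw [Complex.norm_exp_ofReal_mul_I]

theorem integral_norm_pathFourier_pow_six [IsProbabilityMeasure ν] (hW : IsPreBrownianReal W P)
    (hm : Measurable (Function.uncurry W)) (ξ : ℝ) :
    ∫ ω, ‖pathFourier ν W ω ξ‖ ^ 6 ∂P
      = ∫ t, Real.exp (-(2 * Real.pi ^ 2 * ξ ^ 2 * brownianForm ![1, 1, 1, -1, -1, -1] t))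
          ∂(Measure.pi fun _ : Fin 6 ↦ ν) := by
  have h := integral_prod_pathFourier ν hW hm (fun i ↦ ξ * (![1, 1, 1, -1, -1, -1] : Fin 6 → ℝ) i)
  simp_rw [brownianForm_const_mul] at h
  rw [← Complex.ofReal_inj]
  refine Eq.trans ?_ (h.trans ?_)
  · rw [← integral_complex_ofReal]
    refine integral_congr_ae (ae_of_all _ fun ω ↦ ?_)
    simp only [Fin.prod_univ_six, Matrix.cons_val_zero, Matrix.cons_val_one, Matrix.cons_val,
      mul_one, mul_neg, pathFourier_neg]
    have := Complex.mul_conj' (pathFourier ν W ω ξ)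
    push_cast
    linear_combination (-(‖pathFourier ν W ω ξ‖ : ℂ) ^ 4 - (‖pathFourier ν W ω ξ‖ : ℂ) ^ 2
      * (pathFourier ν W ω ξ * starRingEnd ℂ (pathFourier ν W ω ξ))
      - (pathFourier ν W ω ξ * starRingEnd ℂ (pathFourier ν W ω ξ)) ^ 2) * this
  · simp_rw [mul_assoc]

end Fourier

/-! ### The second moment of the trilinear integral -/

section Moments

variable {Ω : Type*} {mΩ : MeasurableSpace Ω} {P : Measure Ω} {W : ℝ≥0 → Ω → ℝ}
  (ν : Measure ℝ≥0)

theorem measurable_uncurry_pathFourier [SFinite ν] (hm : Measurable (Function.uncurry W)) :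
    Measurable (Function.uncurry (pathFourier ν W)) := by
  refine StronglyMeasurable.measurable ?_
  refine StronglyMeasurable.integral_prod_right' (f := fun p : (Ω × ℝ) × ℝ≥0 ↦
    Complex.exp (((-2 * Real.pi * p.1.2) * W p.2 p.1.1 : ℝ) * Complex.I)) ?_
  refine Measurable.stronglyMeasurable ?_
  have h : Measurable fun p : (Ω × ℝ) × ℝ≥0 ↦ W p.2 p.1.1 :=
    hm.comp (f := fun p : (Ω × ℝ) × ℝ≥0 ↦ (p.2, p.1.1)) (by fun_prop)
  fun_prop

/-- The constant in the sixth moment estimate for the Fourier transform. It depends on the Frostman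
constant `C` and the decay exponent `β` only, not on the measure. -/
noncomputable def sixthMomentConst (C β : ℝ) : ℝ :=
  max 1 (720 * (laplaceConst * C) ^ 3) * 2 ^ β

/-- The sixth moment decays like `|ξ| ^ (-β)`, with the same constant for all Frostman measures of
constant `C` and exponent `s ≥ β / 6`. -/
theorem integral_norm_pathFourier_pow_six_le [IsProbabilityMeasure ν]
    (hW : IsPreBrownianReal W P) (hm : Measurable (Function.uncurry W))
    {s C β : ℝ} (hC : 0 ≤ C) (hs1 : s ≤ 1) (hβ : 0 ≤ β) (hβs : β ≤ 6 * s)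
    (hν : ∀ (t : ℝ≥0) (ρ : ℝ), 0 ≤ ρ → ν.real (Metric.closedBall t ρ) ≤ C * (2 * ρ) ^ s)
    (ξ : ℝ) :
    ∫ ω, ‖pathFourier ν W ω ξ‖ ^ 6 ∂P ≤ sixthMomentConst C β * (1 + |ξ|) ^ (-β) := by
  have := hW.isGaussianProcess.isProbabilityMeasure
  have h0 : 0 < 1 + |ξ| := by positivity
  unfold sixthMomentConst
  rcases le_total |ξ| 1 with h | h
  · calc ∫ ω, ‖pathFourier ν W ω ξ‖ ^ 6 ∂P ≤ ∫ _, (1 : ℝ) ∂P := by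
          refine integral_mono_of_nonneg (ae_of_all _ fun _ ↦ by positivity)
            (integrable_const _) (ae_of_all _ fun ω ↦ ?_)
          exact pow_le_one₀ (norm_nonneg _) (norm_pathFourier_le_one ν ω ξ)
      _ = 1 * 1 := by simp
      _ ≤ max 1 (720 * (laplaceConst * C) ^ 3) * (2 ^ β * (1 + |ξ|) ^ (-β)) := by
          refine mul_le_mul (le_max_left _ _) ?_ zero_le_one (by positivity)
          rw [Real.rpow_neg h0.le, ← div_eq_mul_inv, one_le_div (by positivity)]
          exact Real.rpow_le_rpow h0.le (by linarith) hβ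
      _ = _ := by ring
  · have hξ : 0 < ξ ^ 2 := by
      rw [← sq_abs]; positivity
    have hL : 0 < 2 * Real.pi ^ 2 * ξ ^ 2 := by positivity
    rw [integral_norm_pathFourier_pow_six ν hW hm]
    refine (integral_exp_neg_brownianForm_le ν hL.le
      (fun t ↦ integral_exp_neg_dist_le ν hC hs1 hL hν t) _ ?_).trans ?_
    · intro i
      fin_cases i <;> simp
    have e1 : (2 / (2 * Real.pi ^ 2 * ξ ^ 2)) ^ s ≤ |ξ| ^ (-(2 * s)) := by
      have : |ξ| ^ (-(2 * s)) = (|ξ| ^ (-2 : ℝ)) ^ s := by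
        rw [← Real.rpow_mul (abs_nonneg _)]; ring_nf
      rw [this]
      have hs : 0 ≤ s := by linarith
      refine Real.rpow_le_rpow (by positivity) ?_ hs
      rw [Real.rpow_neg (abs_nonneg _), Real.rpow_two, sq_abs, div_le_iff₀ hL]
      have : (ξ ^ 2)⁻¹ * (2 * Real.pi ^ 2 * ξ ^ 2) = 2 * Real.pi ^ 2 := by
        rw [mul_comm, mul_assoc, mul_inv_cancel₀ hξ.ne', mul_one]
      rw [this]
      nlinarith [Real.pi_gt_three]
    calc 720 * (laplaceConst * C * (2 / (2 * Real.pi ^ 2 * ξ ^ 2)) ^ s) ^ 3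
        ≤ 720 * (laplaceConst * C * |ξ| ^ (-(2 * s))) ^ 3 := by
          have := laplaceConst_nonneg
          gcongr
      _ = 720 * (laplaceConst * C) ^ 3 * |ξ| ^ (-(6 * s)) := by
          rw [mul_pow _ (|ξ| ^ (-(2 * s))), ← Real.rpow_mul_natCast (abs_nonneg _)]
          push_cast
          ring_nf
      _ ≤ max 1 (720 * (laplaceConst * C) ^ 3) * (2 ^ β * (1 + |ξ|) ^ (-β)) := by
          refine mul_le_mul (le_max_right _ _) ?_ (by positivity) (by positivity)
          calc |ξ| ^ (-(6 * s)) ≤ |ξ| ^ (-β) :=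
                Real.rpow_le_rpow_of_exponent_le h (by linarith)
            _ ≤ ((1 + |ξ|) / 2) ^ (-β) :=
                Real.rpow_le_rpow_of_nonpos (by positivity) (by linarith) (by linarith)
            _ = 2 ^ β * (1 + |ξ|) ^ (-β) := by
                rw [Real.div_rpow h0.le zero_le_two, Real.rpow_neg zero_le_two, div_inv_eq_mul,
                  mul_comm]
      _ = _ := by ring

/-- The integral of the weight `(1 + |ξ|) ^ (-β / 2)`. -/
noncomputable def weightIntegral (β : ℝ) : ENNReal :=
  ∫⁻ ξ : ℝ, ENNReal.ofReal ((1 + |ξ|) ^ (-(β / 2)))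

theorem weightIntegral_lt_top {β : ℝ} (hβ : 2 < β) : weightIntegral β < ⊤ := by
  have h : Integrable fun ξ : ℝ ↦ (1 + ‖ξ‖) ^ (-(β / 2)) := by
    refine integrable_one_add_norm ?_
    simp
    linarith
  simpa [weightIntegral] using h.lintegral_lt_top

/-- Cauchy–Schwarz with the weight `(1 + |ξ|) ^ (β / 2)`. -/
theorem lintegral_sq_le_weight {g : ℝ → ENNReal} (hg : Measurable g) (β : ℝ) :
    (∫⁻ ξ, g ξ) ^ 2 ≤ (∫⁻ ξ, g ξ ^ 2 * ENNReal.ofReal ((1 + |ξ|) ^ (β / 2))) * weightIntegral β := by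
  have h := ENNReal.lintegral_mul_le_Lp_mul_Lq (volume : Measure ℝ) Real.HolderConjugate.two_two
    (f := fun ξ ↦ g ξ * ENNReal.ofReal ((1 + |ξ|) ^ (β / 4)))
    (g := fun ξ ↦ ENNReal.ofReal ((1 + |ξ|) ^ (-(β / 4)))) (by fun_prop) (by fun_prop)
  have e1 : ∫⁻ ξ, ((fun ξ ↦ g ξ * ENNReal.ofReal ((1 + |ξ|) ^ (β / 4))) *
      (fun ξ : ℝ ↦ ENNReal.ofReal ((1 + |ξ|) ^ (-(β / 4))))) ξ = ∫⁻ ξ, g ξ := by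
    refine lintegral_congr fun ξ ↦ ?_
    have h0 : 0 < 1 + |ξ| := by positivity
    rw [Pi.mul_apply, mul_assoc, ← ENNReal.ofReal_mul (by positivity), ← Real.rpow_add h0]
    simp
  have sq (ξ b : ℝ) : ENNReal.ofReal ((1 + |ξ|) ^ b) ^ 2 = ENNReal.ofReal ((1 + |ξ|) ^ (2 * b)) := by
    have h0 : 0 < 1 + |ξ| := by positivity
    rw [← ENNReal.ofReal_pow (by positivity), ← Real.rpow_mul_natCast h0.le, mul_comm 2 b]
    rfl
  simp only [ENNReal.rpow_ofNat, mul_pow, sq] at h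
  rw [e1] at h
  calc (∫⁻ ξ, g ξ) ^ 2 ≤ _ := pow_le_pow_left₀ zero_le h 2
    _ = _ := by
      rw [mul_pow, ← ENNReal.rpow_mul_natCast, ← ENNReal.rpow_mul_natCast]
      norm_num [weightIntegral]
      congr 4 <;> ext ξ <;> ring_nf

theorem lintegral_sq_lintegral_pow_three_le [IsProbabilityMeasure ν]
    (hW : IsPreBrownianReal W P) (hm : Measurable (Function.uncurry W))
    {s C β : ℝ} (hC : 0 ≤ C) (hs1 : s ≤ 1) (hβ : 0 ≤ β) (hβs : β ≤ 6 * s)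
    (hν : ∀ (t : ℝ≥0) (ρ : ℝ), 0 ≤ ρ → ν.real (Metric.closedBall t ρ) ≤ C * (2 * ρ) ^ s) :
    ∫⁻ ω, (∫⁻ ξ, ‖pathFourier ν W ω ξ‖ₑ ^ 3) ^ 2 ∂P
      ≤ ENNReal.ofReal (sixthMomentConst C β) * weightIntegral β ^ 2 := by
  have := hW.isGaussianProcess.isProbabilityMeasure
  have hF := measurable_uncurry_pathFourier ν hm
  have hF2 (ω : Ω) : Measurable (pathFourier ν W ω) := hF.comp measurable_prodMk_left
  have hF1 (ξ : ℝ) : Measurable fun ω ↦ pathFourier ν W ω ξ := hF.comp measurable_prodMk_right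
  have hFm : Measurable fun p : Ω × ℝ ↦ ‖pathFourier ν W p.1 p.2‖ₑ := hF.enorm
  have h6 (ξ : ℝ) : ∫⁻ ω, ‖pathFourier ν W ω ξ‖ₑ ^ 6 ∂P
      ≤ ENNReal.ofReal (sixthMomentConst C β * (1 + |ξ|) ^ (-β)) := by
    refine le_trans (le_of_eq ?_) (ENNReal.ofReal_le_ofReal
      (integral_norm_pathFourier_pow_six_le ν hW hm hC hs1 hβ hβs hν ξ))
    rw [ofReal_integral_eq_lintegral_ofReal _ (ae_of_all _ fun _ ↦ by positivity)]
    · refine lintegral_congr fun ω ↦ ?_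
      rw [ENNReal.ofReal_pow (norm_nonneg _), ofReal_norm]
    · refine Integrable.of_bound (C := 1)
        (Measurable.aestronglyMeasurable (by fun_prop)) (ae_of_all _ fun ω ↦ ?_)
      rw [norm_pow, norm_norm]
      exact pow_le_one₀ (norm_nonneg _) (norm_pathFourier_le_one ν ω ξ)
  calc ∫⁻ ω, (∫⁻ ξ, ‖pathFourier ν W ω ξ‖ₑ ^ 3) ^ 2 ∂P
      ≤ ∫⁻ ω, (∫⁻ ξ, ‖pathFourier ν W ω ξ‖ₑ ^ 6 * ENNReal.ofReal ((1 + |ξ|) ^ (β / 2)))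
          * weightIntegral β ∂P := by
        refine lintegral_mono fun ω ↦ ?_
        refine (lintegral_sq_le_weight ((hF2 ω).enorm.pow_const 3) β).trans_eq ?_
        simp_rw [← pow_mul]
    _ = (∫⁻ ω, (∫⁻ ξ, ‖pathFourier ν W ω ξ‖ₑ ^ 6 * ENNReal.ofReal ((1 + |ξ|) ^ (β / 2))) ∂P)
          * weightIntegral β := by
        refine lintegral_mul_const _ (Measurable.lintegral_prod_right ?_)
        fun_prop
    _ = (∫⁻ ξ : ℝ, ∫⁻ ω, ‖pathFourier ν W ω ξ‖ₑ ^ 6 * ENNReal.ofReal ((1 + |ξ|) ^ (β / 2)) ∂P)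
          * weightIntegral β := by
        rw [lintegral_lintegral_swap]
        simp only [Function.uncurry_def]
        fun_prop
    _ ≤ (∫⁻ ξ, ENNReal.ofReal (sixthMomentConst C β) * ENNReal.ofReal ((1 + |ξ|) ^ (-(β / 2))))
          * weightIntegral β := by
        gcongr with ξ
        have h0 : 0 < 1 + |ξ| := by positivity
        rw [lintegral_mul_const _ (by fun_prop)]
        refine (mul_le_mul_left (h6 ξ) _).trans_eq ?_
        rw [ENNReal.ofReal_mul (by unfold sixthMomentConst; positivity), mul_assoc,
          ← ENNReal.ofReal_mul (by positivity), ← Real.rpow_add h0]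
        ring_nf
    _ = _ := by
        rw [lintegral_const_mul _ (by fun_prop), sq, mul_assoc]
        rfl

/-- The integrand of the trilinear form of the image of `ν` under `W · ω`. -/
noncomputable def pathIntegrand (ν : Measure ℝ≥0) (W : ℝ≥0 → Ω → ℝ) (ω : Ω) (ξ : ℝ) : ℂ :=
  pathFourier ν W ω ξ * pathFourier ν W ω ξ * pathFourier ν W ω (-2 * ξ)

theorem measurable_uncurry_pathIntegrand [SFinite ν] (hm : Measurable (Function.uncurry W)) :
    Measurable (Function.uncurry (pathIntegrand ν W)) := by
  have hF := measurable_uncurry_pathFourier ν hm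
  have h1 : Measurable fun p : Ω × ℝ ↦ pathFourier ν W p.1 p.2 := hF
  have h2 : Measurable fun p : Ω × ℝ ↦ pathFourier ν W p.1 (-2 * p.2) :=
    hF.comp (f := fun p : Ω × ℝ ↦ (p.1, -2 * p.2)) (by fun_prop)
  exact (h1.mul h1).mul h2

theorem lintegral_enorm_pathIntegrand_le [SFinite ν] (hm : Measurable (Function.uncurry W))
    (ω : Ω) :
    ∫⁻ ξ, ‖pathIntegrand ν W ω ξ‖ₑ ≤ 2 * ∫⁻ ξ, ‖pathFourier ν W ω ξ‖ₑ ^ 3 := by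
  have hF2 : Measurable (pathFourier ν W ω) :=
    (measurable_uncurry_pathFourier ν hm).comp measurable_prodMk_left
  have amgm (a b : ENNReal) : a * a * b ≤ a ^ 3 + b ^ 3 := by
    rcases le_total a b with h | h
    · calc a * a * b ≤ b * b * b := by gcongr
        _ = b ^ 3 := by ring
        _ ≤ _ := le_add_self
    · calc a * a * b ≤ a * a * a := by gcongr
        _ = a ^ 3 := by ring
        _ ≤ _ := le_self_add
  have hmap : ∫⁻ ξ, ‖pathFourier ν W ω (-2 * ξ)‖ₑ ^ 3 ≤ ∫⁻ ξ, ‖pathFourier ν W ω ξ‖ₑ ^ 3 := by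
    have h := lintegral_map (μ := (volume : Measure ℝ)) (hF2.enorm.pow_const 3)
      (measurable_const_mul (-2 : ℝ))
    rw [← h, Real.map_volume_mul_left (by norm_num), lintegral_smul_measure]
    refine mul_le_of_le_one_left zero_le ?_
    norm_num
  calc ∫⁻ ξ, ‖pathIntegrand ν W ω ξ‖ₑ
      ≤ ∫⁻ ξ, (‖pathFourier ν W ω ξ‖ₑ ^ 3 + ‖pathFourier ν W ω (-2 * ξ)‖ₑ ^ 3) := by
        refine lintegral_mono fun ξ ↦ ?_
        rw [pathIntegrand, enorm_mul, enorm_mul]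
        exact amgm _ _
    _ ≤ _ := by
        rw [lintegral_add_left (by fun_prop), two_mul]
        gcongr

theorem lintegral_sq_lintegral_pathIntegrand_le [IsProbabilityMeasure ν]
    (hW : IsPreBrownianReal W P) (hm : Measurable (Function.uncurry W))
    {s C β : ℝ} (hC : 0 ≤ C) (hs1 : s ≤ 1) (hβ : 0 ≤ β) (hβs : β ≤ 6 * s)
    (hν : ∀ (t : ℝ≥0) (ρ : ℝ), 0 ≤ ρ → ν.real (Metric.closedBall t ρ) ≤ C * (2 * ρ) ^ s) :
    ∫⁻ ω, (∫⁻ ξ, ‖pathIntegrand ν W ω ξ‖ₑ) ^ 2 ∂P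
      ≤ 4 * (ENNReal.ofReal (sixthMomentConst C β) * weightIntegral β ^ 2) := by
  calc ∫⁻ ω, (∫⁻ ξ, ‖pathIntegrand ν W ω ξ‖ₑ) ^ 2 ∂P
      ≤ ∫⁻ ω, 4 * (∫⁻ ξ, ‖pathFourier ν W ω ξ‖ₑ ^ 3) ^ 2 ∂P := by
        refine lintegral_mono fun ω ↦ ?_
        refine (pow_le_pow_left₀ zero_le (lintegral_enorm_pathIntegrand_le ν hm ω) 2).trans_eq ?_
        ring
    _ ≤ _ := by
        rw [lintegral_const_mul' _ _ (by norm_num)]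
        gcongr
        exact lintegral_sq_lintegral_pow_three_le ν hW hm hC hs1 hβ hβs hν

end Moments

/-! ### The smoothed trilinear form -/

section Kernel

/-- The Gaussian approximate identity `∫ exp (-b ξ²) cos (2πξu) dξ`, in closed form. It concentrates
at `u = 0` as `b → 0`. -/
noncomputable def gaussKernel (b u : ℝ) : ℝ :=
  √(Real.pi / b) * Real.exp (-(Real.pi ^ 2 * u ^ 2 / b))

theorem gaussKernel_nonneg (b u : ℝ) : 0 ≤ gaussKernel b u := by
  unfold gaussKernel; positivity

theorem gaussKernel_le {b : ℝ} (hb : 0 < b) (u : ℝ) : gaussKernel b u ≤ √(Real.pi / b) := by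
  unfold gaussKernel
  refine mul_le_of_le_one_right (by positivity) ?_
  rw [Real.exp_le_one_iff, neg_nonpos]
  positivity

theorem gaussKernel_anti {b : ℝ} (hb : 0 < b) {u v : ℝ} (hu : 0 ≤ u) (h : u ≤ |v|) :
    gaussKernel b v ≤ gaussKernel b u := by
  unfold gaussKernel
  rw [← sq_abs v]
  gcongr

theorem continuous_gaussKernel (b : ℝ) : Continuous (gaussKernel b) := by
  unfold gaussKernel; fun_prop

theorem integral_exp_mul_cos_eq_gaussKernel {b : ℝ} (hb : 0 < b) (u : ℝ) :
    ∫ ξ : ℝ, Real.exp (-b * ξ ^ 2) * Real.cos (2 * Real.pi * ξ * u) = gaussKernel b u := by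
  have h := congrArg Complex.re (fourierIntegral_gaussian (b := b) (by simpa using hb)
    ((2 * Real.pi * u : ℝ) : ℂ))
  have e1 : ((Real.pi : ℂ) / b) ^ (1 / 2 : ℂ) *
      Complex.exp (-((2 * Real.pi * u : ℝ) : ℂ) ^ 2 / (4 * b)) = (gaussKernel b u : ℝ) := by
    unfold gaussKernel
    have hs : ((√(Real.pi / b) : ℝ) : ℂ) = ((Real.pi : ℂ) / b) ^ (1 / 2 : ℂ) := by
      rw [Real.sqrt_eq_rpow, Complex.ofReal_cpow (by positivity)]
      push_cast
      rfl
    rw [Complex.ofReal_mul (√(Real.pi / b)), hs]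
    push_cast
    congr 2
    field_simp
    ring
  rw [e1, Complex.ofReal_re, ← RCLike.re_eq_complex_re, ← integral_re] at h
  · rw [← h]
    refine integral_congr_ae (ae_of_all _ fun ξ ↦ ?_)
    simp only [RCLike.re_eq_complex_re]
    rw [show Complex.I * ((2 * Real.pi * u : ℝ) : ℂ) * ξ
        = ((2 * Real.pi * ξ * u : ℝ) : ℂ) * Complex.I by push_cast; ring,
      show Complex.exp (-(b : ℂ) * ξ ^ 2) = ((Real.exp (-b * ξ ^ 2) : ℝ) : ℂ) by push_cast; rfl,
      Complex.re_mul_ofReal, Complex.exp_ofReal_mul_I_re, mul_comm]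
  · refine (integrable_exp_neg_mul_sq hb).mono' (Continuous.aestronglyMeasurable (by fun_prop))
      (ae_of_all _ fun ξ ↦ ?_)
    rw [show Complex.I * ((2 * Real.pi * u : ℝ) : ℂ) * ξ
        = ((2 * Real.pi * ξ * u : ℝ) : ℂ) * Complex.I by push_cast; ring,
      show Complex.exp (-(b : ℂ) * ξ ^ 2) = ((Real.exp (-b * ξ ^ 2) : ℝ) : ℂ) by push_cast; rfl,
      norm_mul, Complex.norm_exp_ofReal_mul_I, one_mul, Complex.norm_real,
      Real.norm_of_nonneg (by positivity)]

end Kernel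

section Approximation

variable {Ω : Type*} {mΩ : MeasurableSpace Ω} {P : Measure Ω} {W : ℝ≥0 → Ω → ℝ}
  (ν : Measure ℝ≥0)

/-- The defect `x + y - 2z` of the triple `(x, y, z)` of values of the path at the times `t`. -/
def apDefect (W : ℝ≥0 → Ω → ℝ) (ω : Ω) (t : Fin 3 → ℝ≥0) : ℝ :=
  W (t 0) ω + W (t 1) ω - 2 * W (t 2) ω

/-- The weight `1 - cos (2πκ(x - y))`, which vanishes on the diagonal `x = y`. -/
noncomputable def gapWeight (κ : ℝ) (W : ℝ≥0 → Ω → ℝ) (ω : Ω) (t : Fin 3 → ℝ≥0) : ℝ :=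
  1 - Real.cos (2 * Real.pi * κ * (W (t 0) ω - W (t 1) ω))

/-- The trilinear form of the image of `ν`, smoothed by `gaussKernel b`: an average over triples of
times, which tends to the trilinear form as `b → 0`. -/
noncomputable def smoothForm (ν : Measure ℝ≥0) (b : ℝ) (W : ℝ≥0 → Ω → ℝ) (ω : Ω) : ℝ :=
  ∫ t, gaussKernel b (apDefect W ω t) ∂(Measure.pi fun _ : Fin 3 ↦ ν)

/-- The smoothed trilinear form with the diagonal damped by `gapWeight`, so that it only counts
approximate progressions with a nonzero common difference. -/
noncomputable def dampedForm (ν : Measure ℝ≥0) (b κ : ℝ) (W : ℝ≥0 → Ω → ℝ) (ω : Ω) : ℝ :=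
  ∫ t, gaussKernel b (apDefect W ω t) * gapWeight κ W ω t ∂(Measure.pi fun _ : Fin 3 ↦ ν)

theorem gapWeight_nonneg (κ : ℝ) (ω : Ω) (t : Fin 3 → ℝ≥0) : 0 ≤ gapWeight κ W ω t :=
  sub_nonneg.2 (Real.cos_le_one _)

theorem gapWeight_le_two (κ : ℝ) (ω : Ω) (t : Fin 3 → ℝ≥0) : gapWeight κ W ω t ≤ 2 := by
  unfold gapWeight
  linarith [Real.neg_one_le_cos (2 * Real.pi * κ * (W (t 0) ω - W (t 1) ω))]

theorem measurable_apDefect (hm : Measurable (Function.uncurry W)) :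
    Measurable fun p : Ω × (Fin 3 → ℝ≥0) ↦ apDefect W p.1 p.2 := by
  have h (i : Fin 3) : Measurable fun p : Ω × (Fin 3 → ℝ≥0) ↦ W (p.2 i) p.1 :=
    hm.comp (f := fun p : Ω × (Fin 3 → ℝ≥0) ↦ (p.2 i, p.1)) (by fun_prop)
  unfold apDefect
  fun_prop

theorem measurable_gapWeight (hm : Measurable (Function.uncurry W)) (κ : ℝ) :
    Measurable fun p : Ω × (Fin 3 → ℝ≥0) ↦ gapWeight κ W p.1 p.2 := by
  have h (i : Fin 3) : Measurable fun p : Ω × (Fin 3 → ℝ≥0) ↦ W (p.2 i) p.1 :=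
    hm.comp (f := fun p : Ω × (Fin 3 → ℝ≥0) ↦ (p.2 i, p.1)) (by fun_prop)
  unfold gapWeight
  fun_prop

theorem re_pathIntegrand [IsProbabilityMeasure ν] (hm : Measurable (Function.uncurry W))
    (ω : Ω) (ξ : ℝ) :
    (pathIntegrand ν W ω ξ).re = ∫ t, Real.cos (2 * Real.pi * ξ * apDefect W ω t)
      ∂(Measure.pi fun _ : Fin 3 ↦ ν) := by
  have h := prod_pathFourier (W := W) ν ω (![ξ, ξ, -2 * ξ] : Fin 3 → ℝ)
  simp only [Fin.prod_univ_three, Fin.sum_univ_three, Matrix.cons_val_zero, Matrix.cons_val_one,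
    Matrix.cons_val] at h
  have hU : Measurable (apDefect W ω) := (measurable_apDefect hm).comp measurable_prodMk_left
  have e (t : Fin 3 → ℝ≥0) : -2 * Real.pi * ξ * W (t 0) ω + -2 * Real.pi * ξ * W (t 1) ω +
      -2 * Real.pi * (-2 * ξ) * W (t 2) ω = -(2 * Real.pi * ξ * apDefect W ω t) := by
    unfold apDefect; ring
  simp_rw [e] at h
  rw [pathIntegrand, h, ← RCLike.re_eq_complex_re, ← integral_re]
  · refine integral_congr_ae (ae_of_all _ fun t ↦ ?_)
    simp only [RCLike.re_eq_complex_re]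
    rw [Complex.exp_ofReal_mul_I_re, Real.cos_neg]
  · refine Integrable.of_bound (C := 1) (Measurable.aestronglyMeasurable (by fun_prop))
      (ae_of_all _ fun t ↦ ?_)
    rw [Complex.norm_exp_ofReal_mul_I]

theorem smoothForm_eq_integral [IsProbabilityMeasure ν] (hm : Measurable (Function.uncurry W))
    {b : ℝ} (hb : 0 < b) (ω : Ω) :
    smoothForm ν b W ω = ∫ ξ, Real.exp (-b * ξ ^ 2) * (pathIntegrand ν W ω ξ).re := by
  have hU : Measurable (apDefect W ω) := (measurable_apDefect hm).comp measurable_prodMk_left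
  unfold smoothForm
  simp_rw [← integral_exp_mul_cos_eq_gaussKernel hb]
  rw [integral_integral_swap]
  · refine integral_congr_ae (ae_of_all _ fun ξ ↦ ?_)
    simp only
    rw [integral_const_mul, re_pathIntegrand ν hm]
  · refine Integrable.mono' (g := fun p : (Fin 3 → ℝ≥0) × ℝ ↦ Real.exp (-b * p.2 ^ 2))
      ((integrable_exp_neg_mul_sq hb).comp_snd _) (Measurable.aestronglyMeasurable ?_)
      (ae_of_all _ fun p ↦ ?_)
    · simp only [Function.uncurry_def]
      fun_prop
    · simp only [Function.uncurry_def]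
      rw [norm_mul, Real.norm_of_nonneg (Real.exp_pos _).le]
      exact mul_le_of_le_one_right (by positivity) (Real.abs_cos_le_one _)

theorem ofReal_smoothForm_le [IsProbabilityMeasure ν] (hm : Measurable (Function.uncurry W))
    {b : ℝ} (hb : 0 < b) (ω : Ω) :
    ENNReal.ofReal (smoothForm ν b W ω) ≤ ∫⁻ ξ, ‖pathIntegrand ν W ω ξ‖ₑ := by
  rw [smoothForm_eq_integral ν hm hb]
  refine (Real.ofReal_le_enorm _).trans ((enorm_integral_le_lintegral_enorm _).trans ?_)
  refine lintegral_mono fun ξ ↦ ?_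
  rw [← ofReal_norm, ← ofReal_norm]
  refine ENNReal.ofReal_le_ofReal ?_
  rw [norm_mul]
  refine (mul_le_of_le_one_left (norm_nonneg _) ?_).trans (Complex.abs_re_le_norm _)
  rw [Real.norm_of_nonneg (by positivity), Real.exp_le_one_iff, neg_mul, neg_nonpos]
  positivity

theorem integrable_gaussKernel_apDefect [IsProbabilityMeasure ν]
    (hm : Measurable (Function.uncurry W)) {b : ℝ} (hb : 0 < b) (ω : Ω) :
    Integrable (fun t ↦ gaussKernel b (apDefect W ω t)) (Measure.pi fun _ : Fin 3 ↦ ν) := by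
  have hU : Measurable (apDefect W ω) := (measurable_apDefect hm).comp measurable_prodMk_left
  refine Integrable.of_bound (C := √(Real.pi / b))
    ((continuous_gaussKernel b).measurable.comp hU).aestronglyMeasurable (ae_of_all _ fun t ↦ ?_)
  rw [Real.norm_of_nonneg (gaussKernel_nonneg _ _)]
  exact gaussKernel_le hb _

theorem integrable_uncurry_damped [IsProbabilityMeasure ν] [IsProbabilityMeasure P]
    (hm : Measurable (Function.uncurry W)) {b : ℝ} (hb : 0 < b) (κ : ℝ) :
    Integrable (fun p : Ω × (Fin 3 → ℝ≥0) ↦ gaussKernel b (apDefect W p.1 p.2) *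
      gapWeight κ W p.1 p.2) (P.prod (Measure.pi fun _ : Fin 3 ↦ ν)) := by
  refine Integrable.of_bound (C := √(Real.pi / b) * 2)
    (((continuous_gaussKernel b).measurable.comp (measurable_apDefect hm)).mul
      (measurable_gapWeight hm κ)).aestronglyMeasurable (ae_of_all _ fun p ↦ ?_)
  rw [Real.norm_of_nonneg (mul_nonneg (gaussKernel_nonneg _ _) (gapWeight_nonneg _ _ _))]
  exact mul_le_mul (gaussKernel_le hb _) (gapWeight_le_two _ _ _) (gapWeight_nonneg _ _ _)
    (by positivity)

theorem dampedForm_nonneg (b κ : ℝ) (ω : Ω) : 0 ≤ dampedForm ν b κ W ω :=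
  integral_nonneg fun _ ↦ mul_nonneg (gaussKernel_nonneg _ _) (gapWeight_nonneg _ _ _)

theorem dampedForm_le_two_mul [IsProbabilityMeasure ν] (hm : Measurable (Function.uncurry W))
    {b : ℝ} (hb : 0 < b) (κ : ℝ) (ω : Ω) :
    dampedForm ν b κ W ω ≤ 2 * smoothForm ν b W ω := by
  unfold dampedForm smoothForm
  rw [← integral_const_mul]
  refine integral_mono_of_nonneg
    (ae_of_all _ fun _ ↦ mul_nonneg (gaussKernel_nonneg _ _) (gapWeight_nonneg _ _ _))
    ((integrable_gaussKernel_apDefect ν hm hb ω).const_mul 2) (ae_of_all _ fun t ↦ ?_)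
  simp only
  rw [mul_comm 2]
  exact mul_le_mul_of_nonneg_left (gapWeight_le_two _ _ _) (gaussKernel_nonneg _ _)

theorem stronglyMeasurable_dampedForm [IsProbabilityMeasure ν] (hm : Measurable (Function.uncurry W))
    (b κ : ℝ) : StronglyMeasurable (dampedForm ν b κ W) := by
  refine StronglyMeasurable.integral_prod_right' (f := fun p : Ω × (Fin 3 → ℝ≥0) ↦
    gaussKernel b (apDefect W p.1 p.2) * gapWeight κ W p.1 p.2) ?_
  exact (((continuous_gaussKernel b).measurable.comp (measurable_apDefect hm)).mul
      (measurable_gapWeight hm κ)).stronglyMeasurable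

theorem integrable_dampedForm [IsProbabilityMeasure ν] [IsProbabilityMeasure P]
    (hm : Measurable (Function.uncurry W)) {b : ℝ} (hb : 0 < b) (κ : ℝ) :
    Integrable (dampedForm ν b κ W) P :=
  (integrable_uncurry_damped ν hm hb κ).integral_prod_left

/-- The weight `1 - cos` shifts the frequencies of `W (t 0)` and `W (t 1)` by `± κ`, so the
expectation stays a combination of Gaussian characteristic functions. -/
theorem integral_cos_apDefect_mul_gapWeight (hW : IsPreBrownianReal W P)
    (κ ξ : ℝ) (t : Fin 3 → ℝ≥0) :
    ∫ ω, Real.cos (2 * Real.pi * ξ * apDefect W ω t) * gapWeight κ W ω t ∂P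
      = Real.exp (-(2 * Real.pi ^ 2 * brownianForm ![ξ, ξ, -2 * ξ] t))
        - Real.exp (-(2 * Real.pi ^ 2 * brownianForm ![ξ + κ, ξ - κ, -2 * ξ] t)) / 2
        - Real.exp (-(2 * Real.pi ^ 2 * brownianForm ![ξ - κ, ξ + κ, -2 * ξ] t)) / 2 := by
  have := hW.isGaussianProcess.isProbabilityMeasure
  have hE (a : Fin 3 → ℝ) :
      ∫ ω, Real.cos (∑ i, (2 * Real.pi * a i) * W (t i) ω) ∂P
        = Real.exp (-(2 * Real.pi ^ 2 * brownianForm a t)) := by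
    rw [integral_cos_sum_mul hW, brownianForm_const_mul]
    ring_nf
  have hI (a : Fin 3 → ℝ) :
      Integrable (fun ω ↦ Real.cos (∑ i, (2 * Real.pi * a i) * W (t i) ω)) P := by
    have hm := fun i ↦ hW.aemeasurable (t i)
    refine Integrable.of_bound (C := 1) (AEMeasurable.aestronglyMeasurable ?_)
      (ae_of_all _ fun ω ↦ Real.abs_cos_le_one _)
    exact Real.measurable_cos.comp_aemeasurable (by fun_prop)
  have hI2 (a a' : Fin 3 → ℝ) :
      Integrable (fun ω ↦ Real.cos (∑ i, (2 * Real.pi * a i) * W (t i) ω)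
        - Real.cos (∑ i, (2 * Real.pi * a' i) * W (t i) ω) / 2) P :=
    (hI a).sub ((hI a').div_const 2)
  rw [← hE, ← hE, ← hE, ← integral_div, ← integral_div, ← integral_sub (hI _) ((hI _).div_const 2),
    ← integral_sub (hI2 _ _) ((hI _).div_const 2)]
  refine integral_congr_ae (ae_of_all _ fun ω ↦ ?_)
  simp only [Fin.sum_univ_three, Matrix.cons_val_zero, Matrix.cons_val_one, Matrix.cons_val,
    gapWeight, apDefect]
  have e1 := Real.cos_add (2 * Real.pi * ξ * (W (t 0) ω + W (t 1) ω - 2 * W (t 2) ω))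
    (2 * Real.pi * κ * (W (t 0) ω - W (t 1) ω))
  have e2 := Real.cos_sub (2 * Real.pi * ξ * (W (t 0) ω + W (t 1) ω - 2 * W (t 2) ω))
    (2 * Real.pi * κ * (W (t 0) ω - W (t 1) ω))
  rw [show 2 * Real.pi * ξ * W (t 0) ω + 2 * Real.pi * ξ * W (t 1) ω +
      2 * Real.pi * (-2 * ξ) * W (t 2) ω
      = 2 * Real.pi * ξ * (W (t 0) ω + W (t 1) ω - 2 * W (t 2) ω) by ring,
    show 2 * Real.pi * (ξ + κ) * W (t 0) ω + 2 * Real.pi * (ξ - κ) * W (t 1) ω +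
      2 * Real.pi * (-2 * ξ) * W (t 2) ω
      = 2 * Real.pi * ξ * (W (t 0) ω + W (t 1) ω - 2 * W (t 2) ω) +
        2 * Real.pi * κ * (W (t 0) ω - W (t 1) ω) by ring,
    show 2 * Real.pi * (ξ - κ) * W (t 0) ω + 2 * Real.pi * (ξ + κ) * W (t 1) ω +
      2 * Real.pi * (-2 * ξ) * W (t 2) ω
      = 2 * Real.pi * ξ * (W (t 0) ω + W (t 1) ω - 2 * W (t 2) ω) -
        2 * Real.pi * κ * (W (t 0) ω - W (t 1) ω) by ring, e1, e2]
  ring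

theorem integrable_uncurry_exp_mul_cos_mul_gapWeight [IsProbabilityMeasure P]
    (hm : Measurable (Function.uncurry W)) {b : ℝ} (hb : 0 < b) (κ : ℝ) (t : Fin 3 → ℝ≥0) :
    Integrable (fun p : Ω × ℝ ↦ Real.exp (-b * p.2 ^ 2) *
      (Real.cos (2 * Real.pi * p.2 * apDefect W p.1 t) * gapWeight κ W p.1 t))
      (P.prod volume) := by
  have hWt (i : Fin 3) : Measurable (W (t i)) := hm.comp measurable_prodMk_left
  have hU : Measurable fun ω ↦ apDefect W ω t := by
    unfold apDefect; fun_prop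
  have hV : Measurable fun ω ↦ gapWeight κ W ω t := by
    unfold gapWeight; fun_prop
  have hG : Integrable (fun p : Ω × ℝ ↦ Real.exp (-b * p.2 ^ 2) * 2) (P.prod volume) :=
    Integrable.comp_snd (f := fun ξ : ℝ ↦ Real.exp (-b * ξ ^ 2) * 2)
      ((integrable_exp_neg_mul_sq hb).mul_const 2) P
  have hU2 : Measurable fun p : Ω × ℝ ↦ apDefect W p.1 t := hU.comp measurable_fst
  have hV2 : Measurable fun p : Ω × ℝ ↦ gapWeight κ W p.1 t := hV.comp measurable_fst
  have hM : Measurable fun p : Ω × ℝ ↦ Real.exp (-b * p.2 ^ 2) *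
      (Real.cos (2 * Real.pi * p.2 * apDefect W p.1 t) * gapWeight κ W p.1 t) := by
    refine Measurable.mul (by fun_prop) (Measurable.mul ?_ hV2)
    exact Real.measurable_cos.comp ((measurable_snd.const_mul (2 * Real.pi)).mul hU2)
  refine hG.mono' hM.aestronglyMeasurable (ae_of_all _ fun p ↦ ?_)
  rw [norm_mul, Real.norm_of_nonneg (Real.exp_pos _).le, norm_mul]
  refine mul_le_mul_of_nonneg_left ?_ (Real.exp_pos _).le
  rw [Real.norm_of_nonneg (gapWeight_nonneg _ _ _)]
  exact (mul_le_of_le_one_left (gapWeight_nonneg _ _ _) (Real.abs_cos_le_one _)).trans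
    (gapWeight_le_two _ _ _)

/-- For separated times the damped kernel has expectation bounded below uniformly in `b ≤ 1`, once
`κ` is large: the shifted frequencies contribute only a multiple of `exp (-(4/3) π² r κ²)`. -/
theorem le_integral_gaussKernel_mul_gapWeight (hW : IsPreBrownianReal W P)
    (hm : Measurable (Function.uncurry W)) {b : ℝ} (hb : 0 < b) (hb1 : b ≤ 1) (κ : ℝ) {r : ℝ}
    (hr : 0 < r) {t : Fin 3 → ℝ≥0} (ht1 : ∀ i, t i ≤ 1)
    (ht : ∀ i j, i ≠ j → r ≤ dist (t i) (t j)) :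
    √(Real.pi / (1 + 32 * Real.pi ^ 2))
        - Real.exp (-(4 / 3 * Real.pi ^ 2 * r * κ ^ 2)) * √(Real.pi / (4 * Real.pi ^ 2 * r))
      ≤ ∫ ω, gaussKernel b (apDefect W ω t) * gapWeight κ W ω t ∂P := by
  have := hW.isGaussianProcess.isProbabilityMeasure
  have hH := integrable_uncurry_exp_mul_cos_mul_gapWeight (P := P) hm hb κ t
  have hk1 : 0 < 1 + 32 * Real.pi ^ 2 := by positivity
  have hk2 : 0 < 4 * Real.pi ^ 2 * r := by positivity
  have hker (ω : Ω) : gaussKernel b (apDefect W ω t) * gapWeight κ W ω t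
      = ∫ ξ : ℝ, Real.exp (-b * ξ ^ 2) *
        (Real.cos (2 * Real.pi * ξ * apDefect W ω t) * gapWeight κ W ω t) := by
    rw [← integral_exp_mul_cos_eq_gaussKernel hb, ← integral_mul_const]
    refine integral_congr_ae (ae_of_all _ fun ξ ↦ ?_)
    simp only
    rw [mul_assoc]
  simp_rw [hker]
  have hI1 := integrable_exp_neg_mul_sq hk1
  have hI2 := (integrable_exp_neg_mul_sq hk2).const_mul
    (Real.exp (-(4 / 3 * Real.pi ^ 2 * r * κ ^ 2)))
  rw [integral_integral_swap hH, ← integral_gaussian, ← integral_gaussian, ← integral_const_mul,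
    ← integral_sub hI1 hI2]
  refine integral_mono (hI1.sub hI2) hH.integral_prod_right fun ξ ↦ ?_
  simp only
  rw [integral_const_mul, integral_cos_apDefect_mul_gapWeight hW κ ξ t]
  have hsep (a : Fin 3 → ℝ) (ha : a 0 + a 1 + a 2 = 0)
      (hsq : a 0 ^ 2 + a 1 ^ 2 + a 2 ^ 2 = 6 * ξ ^ 2 + 2 * κ ^ 2) :
      Real.exp (-b * ξ ^ 2) * Real.exp (-(2 * Real.pi ^ 2 * brownianForm a t))
        ≤ Real.exp (-(4 / 3 * Real.pi ^ 2 * r * κ ^ 2)) * Real.exp (-(4 * Real.pi ^ 2 * r) * ξ ^ 2) := by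
    have h := le_brownianForm_of_separated hr.le ht a ha
    rw [hsq] at h
    rw [← Real.exp_add, ← Real.exp_add]
    refine Real.exp_le_exp.2 ?_
    have h1 := mul_le_mul_of_nonneg_left h (sq_nonneg Real.pi)
    have h2 : 0 ≤ b * ξ ^ 2 := by positivity
    linarith
  have hQ : brownianForm ![ξ, ξ, -2 * ξ] t ≤ 16 * ξ ^ 2 := by
    have e : (![ξ, ξ, -2 * ξ] : Fin 3 → ℝ) = fun i ↦ ξ * (![1, 1, -2] : Fin 3 → ℝ) i := by
      funext i
      fin_cases i <;> simp
      ring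
    rw [e, brownianForm_const_mul, mul_comm]
    exact mul_le_mul_of_nonneg_right (brownianForm_fin_three_le ht1) (sq_nonneg ξ)
  have hmain : Real.exp (-(1 + 32 * Real.pi ^ 2) * ξ ^ 2) ≤ Real.exp (-b * ξ ^ 2) *
      Real.exp (-(2 * Real.pi ^ 2 * brownianForm ![ξ, ξ, -2 * ξ] t)) := by
    rw [← Real.exp_add]
    refine Real.exp_le_exp.2 ?_
    have h1 := mul_le_mul_of_nonneg_left hQ (sq_nonneg Real.pi)
    have h2 : b * ξ ^ 2 ≤ 1 * ξ ^ 2 := by gcongr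
    linarith
  have s1 := hsep ![ξ + κ, ξ - κ, -2 * ξ] (by simp; ring) (by simp; ring)
  have s2 := hsep ![ξ - κ, ξ + κ, -2 * ξ] (by simp; ring) (by simp; ring)
  rw [mul_sub, mul_sub, mul_div_assoc', mul_div_assoc']
  linarith

end Approximation

/-! ### Positive probability from two moments -/

section Probability

variable {Ω : Type*} {mΩ : MeasurableSpace Ω} {P : Measure Ω}

/-- A Paley–Zygmund inequality, with the threshold `c / 2` for a mean of at least `c`. -/
theorem le_measureReal_lt_of_secondMoment_le [IsProbabilityMeasure P] {Z : Ω → ℝ} {c M : ℝ}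
    (hc : 0 < c) (hM : 0 < M) (hZm : Measurable Z) (hZ0 : ∀ ω, 0 ≤ Z ω) (hZi : Integrable Z P)
    (hcZ : c ≤ ∫ ω, Z ω ∂P) (hZM : ∫⁻ ω, ENNReal.ofReal (Z ω) ^ 2 ∂P ≤ ENNReal.ofReal M) :
    c ^ 2 / (4 * M) ≤ P.real {ω | c / 2 < Z ω} := by
  have hB : MeasurableSet {ω | c / 2 < Z ω} := measurableSet_lt measurable_const hZm
  have hsq : ∫⁻ ω, ENNReal.ofReal (Z ω ^ 2) ∂P ≤ ENNReal.ofReal M := by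
    simpa only [ENNReal.ofReal_pow (hZ0 _)] using hZM
  have hZ2 : Integrable (fun ω ↦ Z ω ^ 2) P := by
    refine ⟨(hZm.pow_const 2).aestronglyMeasurable, ?_⟩
    rw [hasFiniteIntegral_iff_ofReal (ae_of_all _ fun ω ↦ sq_nonneg _)]
    exact hsq.trans_lt ENNReal.ofReal_lt_top
  have hZ2M : ∫ ω, Z ω ^ 2 ∂P ≤ M := by
    rw [integral_eq_lintegral_of_nonneg_ae (ae_of_all _ fun ω ↦ sq_nonneg _)
      hZ2.aestronglyMeasurable]
    exact ENNReal.toReal_le_of_le_ofReal hM.le hsq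
  have hI : Integrable ({ω | c / 2 < Z ω}.indicator fun _ ↦ M / c) P :=
    (integrable_const _).indicator hB
  have hpt : ∫ ω, Z ω ∂P ≤ ∫ ω, (c / 2 + (c / (4 * M) * Z ω ^ 2
      + {ω | c / 2 < Z ω}.indicator (fun _ ↦ M / c) ω)) ∂P := by
    refine integral_mono hZi
      ((integrable_const _).add ((hZ2.const_mul _).add hI)) fun ω ↦ ?_
    by_cases h : c / 2 < Z ω
    · simp only
      rw [Set.indicator_of_mem (show ω ∈ {ω | c / 2 < Z ω} from h)]
      -- `Z ≤ c / (4M) * Z² + M / c`, the two terms balanced so that the first has mean `≤ c / 4`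
      have : 0 ≤ c / (4 * M) * (Z ω - 2 * M / c) ^ 2 := by positivity
      have e : c / (4 * M) * (Z ω - 2 * M / c) ^ 2
          = c / (4 * M) * Z ω ^ 2 + M / c - Z ω := by
        field_simp
        ring
      linarith
    · simp only
      rw [Set.indicator_of_notMem (show ω ∉ {ω | c / 2 < Z ω} from h)]
      have : 0 ≤ c / (4 * M) * Z ω ^ 2 := by positivity
      linarith
  have hI2 : Integrable (fun ω ↦ c / (4 * M) * Z ω ^ 2
      + {ω | c / 2 < Z ω}.indicator (fun _ ↦ M / c) ω) P := (hZ2.const_mul _).add hI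
  rw [integral_add (integrable_const _) hI2,
    integral_add (hZ2.const_mul _) hI, integral_const_mul, integral_indicator_const _ hB] at hpt
  simp only [integral_const, probReal_univ, smul_eq_mul, one_mul] at hpt
  have h1 : c / (4 * M) * ∫ ω, Z ω ^ 2 ∂P ≤ c / 4 := by
    calc c / (4 * M) * ∫ ω, Z ω ^ 2 ∂P ≤ c / (4 * M) * M := by gcongr
      _ = c / 4 := by field_simp
  have h2 : c / 4 ≤ P.real {ω | c / 2 < Z ω} * (M / c) := by linarith
  calc c ^ 2 / (4 * M) = c / 4 * (c / M) := by field_simp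
    _ ≤ P.real {ω | c / 2 < Z ω} * (M / c) * (c / M) := by gcongr
    _ = P.real {ω | c / 2 < Z ω} := by field_simp

theorem setOf_frequently_mem_eq (A : ℕ → Set Ω) :
    {ω | ∃ᶠ n in Filter.atTop, ω ∈ A n} = ⋂ n, ⋃ m ≥ n, A m := by
  ext ω
  simp [Filter.frequently_atTop]

theorem measurableSet_frequently_mem {A : ℕ → Set Ω} (hA : ∀ n, MeasurableSet (A n)) :
    MeasurableSet {ω | ∃ᶠ n in Filter.atTop, ω ∈ A n} := by
  rw [setOf_frequently_mem_eq]
  exact MeasurableSet.iInter fun n ↦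
    MeasurableSet.biUnion (Set.to_countable {m | m ≥ n}) fun m _ ↦ hA m

/-- Fatou's lemma for events: if every `A n` has probability at least `c`, so does the event that
infinitely many of them occur. -/
theorem le_measureReal_frequently_mem [IsFiniteMeasure P] {A : ℕ → Set Ω} (hA : ∀ n, MeasurableSet (A n))
    {c : ℝ} (hc : ∀ n, c ≤ P.real (A n)) :
    c ≤ P.real {ω | ∃ᶠ n in Filter.atTop, ω ∈ A n} := by
  have hanti : Antitone fun n ↦ ⋃ m ≥ n, A m := by
    intro n n' h
    exact Set.biUnion_subset_biUnion_left fun m hm ↦ le_trans h hm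
  have h := tendsto_measure_iInter_atTop (μ := P)
    (fun n ↦ (MeasurableSet.biUnion (Set.to_countable {m | m ≥ n})
      fun m _ ↦ hA m).nullMeasurableSet) hanti ⟨0, measure_ne_top _ _⟩
  rw [setOf_frequently_mem_eq]
  refine ge_of_tendsto' ((ENNReal.tendsto_toReal (measure_ne_top P _)).comp h) fun n ↦ ?_
  refine (hc n).trans (measureReal_mono ?_ (measure_ne_top _ _))
  exact Set.subset_biUnion_of_mem (s := {m | m ≥ n}) (u := A) (le_refl n)

end Probability

/-! ### The mean of the damped form -/

section Separated

variable (ν : Measure ℝ≥0) [IsProbabilityMeasure ν]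

theorem measure_pi_dist_lt_le {ι : Type*} [Fintype ι] {r : ℝ} {q : ENNReal}
    (hq : ∀ t, ν (Metric.closedBall t r) ≤ q) {i j : ι} (hij : i ≠ j) :
    (Measure.pi fun _ : ι ↦ ν) {t | dist (t i) (t j) < r} ≤ q := by
  have hind : iIndepFun (fun i (t : ι → ℝ≥0) ↦ t i) (Measure.pi fun _ : ι ↦ ν) :=
    iIndepFun_pi (X := fun _ : ι ↦ (id : ℝ≥0 → ℝ≥0)) fun _ ↦ aemeasurable_id
  have h := (indepFun_iff_map_prod_eq_prod_map_map (measurable_pi_apply i).aemeasurable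
    (measurable_pi_apply j).aemeasurable).1 (hind.indepFun hij)
  rw [(measurePreserving_eval (fun _ : ι ↦ ν) i).map_eq,
    (measurePreserving_eval (fun _ : ι ↦ ν) j).map_eq] at h
  have hS : MeasurableSet {p : ℝ≥0 × ℝ≥0 | dist p.1 p.2 < r} :=
    measurableSet_lt (by fun_prop) measurable_const
  have e : {t : ι → ℝ≥0 | dist (t i) (t j) < r}
      = (fun t : ι → ℝ≥0 ↦ (t i, t j)) ⁻¹' {p : ℝ≥0 × ℝ≥0 | dist p.1 p.2 < r} := rfl
  rw [e, ← Measure.map_apply (by fun_prop) hS, h, Measure.prod_apply hS]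
  refine (lintegral_mono (g := fun _ ↦ q) fun t ↦ ?_).trans (by simp)
  refine (measure_mono fun t' ht' ↦ ?_).trans (hq t)
  rw [Metric.mem_closedBall']
  exact le_of_lt ht'

theorem measurableSet_separated (r : ℝ) :
    MeasurableSet {t : Fin 3 → ℝ≥0 | ∀ i j, i ≠ j → r ≤ dist (t i) (t j)} := by
  simp only [Set.ofPred_forall]
  refine MeasurableSet.iInter fun i ↦ MeasurableSet.iInter fun j ↦ MeasurableSet.iInter fun _ ↦ ?_
  exact measurableSet_le measurable_const (by fun_prop)

/-- Each of the three pairs of times is within `r` with probability at most `1 / 6`. -/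
theorem half_le_measureReal_separated {r : ℝ}
    (hq : ∀ t, ν.real (Metric.closedBall t r) ≤ 1 / 6) :
    1 / 2 ≤ (Measure.pi fun _ : Fin 3 ↦ ν).real
      {t | ∀ i j, i ≠ j → r ≤ dist (t i) (t j)} := by
  set μ := Measure.pi fun _ : Fin 3 ↦ ν
  have hpair {i j : Fin 3} (hij : i ≠ j) : μ.real {t | dist (t i) (t j) < r} ≤ 1 / 6 := by
    refine ENNReal.toReal_le_of_le_ofReal (by norm_num) (measure_pi_dist_lt_le ν (fun t ↦ ?_) hij)
    rw [← ofReal_measureReal]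
    exact ENNReal.ofReal_le_ofReal (hq t)
  have hG := measurableSet_separated r
  have hsub : {t : Fin 3 → ℝ≥0 | ∀ i j, i ≠ j → r ≤ dist (t i) (t j)}ᶜ
      ⊆ ({t | dist (t 0) (t 1) < r} ∪ {t | dist (t 0) (t 2) < r}) ∪ {t | dist (t 1) (t 2) < r} := by
    intro t ht
    by_contra hn
    simp only [Set.mem_union, Set.mem_ofPred_eq, not_or, not_lt] at hn
    obtain ⟨⟨h01, h02⟩, h12⟩ := hn
    refine ht fun i j hij ↦ ?_
    fin_cases i <;> fin_cases j <;>
      first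
        | exact absurd rfl hij
        | assumption
        | (rw [dist_comm]; assumption)
  have h1 := measureReal_mono (μ := μ) hsub
  have h2 := measureReal_union_le (μ := μ)
    ({t | dist (t 0) (t 1) < r} ∪ {t | dist (t 0) (t 2) < r}) {t | dist (t 1) (t 2) < r}
  have h3 := measureReal_union_le (μ := μ) {t | dist (t 0) (t 1) < r} {t | dist (t 0) (t 2) < r}
  have h4 := probReal_compl_eq_one_sub (μ := μ) hG
  have a := hpair (i := 0) (j := 1) (by decide)
  have b := hpair (i := 0) (j := 2) (by decide)
  have c := hpair (i := 1) (j := 2) (by decide)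
  linarith

end Separated

section Limits

variable {Ω : Type*} {mΩ : MeasurableSpace Ω} {P : Measure Ω} {W : ℝ≥0 → Ω → ℝ}
  (ν : Measure ℝ≥0) [IsProbabilityMeasure ν]

theorem le_integral_dampedForm (hW : IsPreBrownianReal W P)
    (hm : Measurable (Function.uncurry W)) (hν1 : ∀ᵐ t ∂ν, t ≤ 1)
    {b : ℝ} (hb : 0 < b) (hb1 : b ≤ 1) (κ : ℝ) {r : ℝ} (hr : 0 < r)
    (hq : ∀ t, ν.real (Metric.closedBall t r) ≤ 1 / 6) {c : ℝ} (hc : 0 ≤ c)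
    (hcκ : c ≤ √(Real.pi / (1 + 32 * Real.pi ^ 2))
        - Real.exp (-(4 / 3 * Real.pi ^ 2 * r * κ ^ 2)) * √(Real.pi / (4 * Real.pi ^ 2 * r))) :
    c / 2 ≤ ∫ ω, dampedForm ν b κ W ω ∂P := by
  have := hW.isGaussianProcess.isProbabilityMeasure
  have hI := integrable_uncurry_damped (P := P) ν hm hb κ
  have hG := measurableSet_separated r
  have h1 : ∀ᵐ t ∂(Measure.pi fun _ : Fin 3 ↦ ν), ∀ i, t i ≤ 1 :=
    ae_all_iff.2 fun i ↦ (measurePreserving_eval (fun _ : Fin 3 ↦ ν) i).quasiMeasurePreserving.ae hν1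
  unfold dampedForm
  rw [integral_integral_swap hI]
  calc c / 2 ≤ (Measure.pi fun _ : Fin 3 ↦ ν).real
          {t | ∀ i j, i ≠ j → r ≤ dist (t i) (t j)} * c := by
        have := mul_le_mul_of_nonneg_right (half_le_measureReal_separated ν hq) hc
        linarith
    _ = ∫ t, {t : Fin 3 → ℝ≥0 | ∀ i j, i ≠ j → r ≤ dist (t i) (t j)}.indicator (fun _ ↦ c) t
          ∂(Measure.pi fun _ : Fin 3 ↦ ν) := by
        rw [integral_indicator_const _ hG, smul_eq_mul]
    _ ≤ _ := by
        refine integral_mono_ae ((integrable_const _).indicator hG) hI.integral_prod_right ?_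
        filter_upwards [h1] with t ht
        refine Set.indicator_apply_le' (fun hsep ↦ ?_) fun _ ↦ ?_
        · exact hcκ.trans (le_integral_gaussKernel_mul_gapWeight hW hm hb hb1 κ hr ht hsep)
        · exact integral_nonneg fun _ ↦ mul_nonneg (gaussKernel_nonneg _ _) (gapWeight_nonneg _ _ _)

/-! ### The limit of vanishing smoothing -/

theorem tendsto_gaussKernel_one_div {d : ℝ} (hd : 0 < d) :
    Filter.Tendsto (fun n : ℕ ↦ gaussKernel (1 / ((n : ℝ) + 1)) d) Filter.atTop (nhds 0) := by
  have h := (tendsto_rpow_mul_exp_neg_mul_atTop_nhds_zero (1 / 2) (Real.pi ^ 2 * d ^ 2)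
    (by positivity)).comp
    (Filter.tendsto_atTop_add_const_right _ (1 : ℝ) tendsto_natCast_atTop_atTop)
  have h2 := h.const_mul (√Real.pi)
  rw [mul_zero] at h2
  refine h2.congr fun n ↦ ?_
  simp only [Function.comp_apply, gaussKernel]
  rw [← Real.sqrt_eq_rpow, ← mul_assoc, ← Real.sqrt_mul Real.pi_pos.le]
  congr 2
  · simp
  · simp

/-- If the damped forms stay away from `0` along `b → 0` while the smoothed forms stay bounded, the
closed set `E` carrying the image contains a nontrivial progression. Triples of nearly equal points
contribute at most `η` times the smoothed form; without a progression, `apDefect` is bounded away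
from `0` on the compact set of the remaining triples, where the kernel tends to `0`. -/
theorem exists_progression_of_frequently_lt_dampedForm {ω : Ω} (hm : Measurable (Function.uncurry W))
    (hcont : Continuous (W · ω)) (hν1 : ∀ᵐ t ∂ν, t ≤ 1) {E : Set ℝ} (hE : IsClosed E)
    (hνE : ∀ᵐ t ∂ν, W t ω ∈ E) {κ c M : ℝ} (hc : 0 < c) (hM : 0 ≤ M)
    (hsm : ∀ n : ℕ, smoothForm ν (1 / ((n : ℝ) + 1)) W ω ≤ M)
    (hfr : ∃ᶠ n : ℕ in Filter.atTop, c < dampedForm ν (1 / ((n : ℝ) + 1)) κ W ω) :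
    HasThreeAP E := by
  set η : ℝ := c / (2 * (M + 1)) with hη
  have hη0 : 0 < η := by positivity
  have hUc : Continuous (apDefect W ω) := by unfold apDefect; fun_prop
  have hVc : Continuous (gapWeight κ W ω) := by unfold gapWeight; fun_prop
  set T : Set ℝ≥0 := Set.Icc 0 1 ∩ {t | W t ω ∈ E}
  have hT : IsCompact T := isCompact_Icc.inter_right (hE.preimage hcont)
  set S : Set (Fin 3 → ℝ≥0) := (Set.univ.pi fun _ ↦ T) ∩ {t | η ≤ gapWeight κ W ω t}
  have hS : IsCompact S :=
    (isCompact_univ_pi fun _ ↦ hT).inter_right (isClosed_le continuous_const hVc)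
  have hTae : ∀ᵐ t ∂(Measure.pi fun _ : Fin 3 ↦ ν), t ∈ Set.univ.pi fun _ : Fin 3 ↦ T := by
    have hT1 : ∀ᵐ t ∂ν, t ∈ T := by
      filter_upwards [hν1, hνE] with t h1 h2 using ⟨⟨zero_le, h1⟩, h2⟩
    have := ae_all_iff.2 fun i ↦
      (measurePreserving_eval (fun _ : Fin 3 ↦ ν) i).quasiMeasurePreserving.ae hT1
    filter_upwards [this] with t ht i _ using ht i
  by_cases hzero : ∃ t ∈ S, apDefect W ω t = 0
  · obtain ⟨t, ⟨htT, htη⟩, ht0⟩ := hzero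
    refine ⟨W (t 0) ω, (htT 0 trivial).2, W (t 1) ω, (htT 1 trivial).2, fun h ↦ ?_, ?_⟩
    · have h0 : gapWeight κ W ω t = 0 := by simp [gapWeight, h]
      rw [Set.mem_ofPred_eq, h0] at htη
      exact absurd htη (not_le.2 hη0)
    · have : (W (t 0) ω + W (t 1) ω) / 2 = W (t 2) ω := by
        unfold apDefect at ht0
        linarith
      rw [this]
      exact (htT 2 trivial).2
  · exfalso
    push Not at hzero
    obtain ⟨d, hd, hdS⟩ := hS.exists_forall_le' (f := fun t ↦ |apDefect W ω t|) (a := 0)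
      hUc.abs.continuousOn fun t ht ↦ abs_pos.2 (hzero t ht)
    have hev : ∀ᶠ n : ℕ in Filter.atTop, 2 * gaussKernel (1 / ((n : ℝ) + 1)) d < c / 2 := by
      have := (tendsto_gaussKernel_one_div hd).const_mul 2
      rw [mul_zero] at this
      exact this.eventually_lt_const (by positivity)
    obtain ⟨n, hn1, hn2⟩ := (hfr.and_eventually hev).exists
    have hb : (0 : ℝ) < 1 / ((n : ℝ) + 1) := by positivity
    have hle : dampedForm ν (1 / ((n : ℝ) + 1)) κ W ω
        ≤ ∫ t, (η * gaussKernel (1 / ((n : ℝ) + 1)) (apDefect W ω t)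
          + 2 * gaussKernel (1 / ((n : ℝ) + 1)) d) ∂(Measure.pi fun _ : Fin 3 ↦ ν) := by
      refine integral_mono_of_nonneg
        (ae_of_all _ fun _ ↦ mul_nonneg (gaussKernel_nonneg _ _) (gapWeight_nonneg _ _ _))
        (((integrable_gaussKernel_apDefect ν hm hb ω).const_mul η).add (integrable_const _)) ?_
      filter_upwards [hTae] with t ht
      have k0 := gaussKernel_nonneg (1 / ((n : ℝ) + 1)) (apDefect W ω t)
      have k1 := gaussKernel_nonneg (1 / ((n : ℝ) + 1)) d
      rcases le_total η (gapWeight κ W ω t) with h | h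
      · have h1 := gaussKernel_anti hb hd.le (hdS t ⟨ht, h⟩)
        have h2 := mul_le_mul h1 (gapWeight_le_two (W := W) κ ω t) (gapWeight_nonneg κ ω t) k1
        have h3 := mul_nonneg hη0.le k0
        linarith
      · have h2 := mul_le_mul_of_nonneg_left h k0
        linarith
    rw [integral_add ((integrable_gaussKernel_apDefect ν hm hb ω).const_mul η)
      (integrable_const _), integral_const_mul] at hle
    simp only [integral_const, probReal_univ, smul_eq_mul, one_mul] at hle
    have h4 : η * smoothForm ν (1 / ((n : ℝ) + 1)) W ω ≤ c / 2 := by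
      calc η * smoothForm ν (1 / ((n : ℝ) + 1)) W ω ≤ η * M := by gcongr; exact hsm n
        _ ≤ η * (M + 1) := by gcongr; linarith
        _ = c / 2 := by rw [hη]; field_simp
    unfold smoothForm at h4
    linarith

/-- The smoothed forms converge to the trilinear form when the latter converges absolutely. -/
theorem tendsto_smoothForm (hm : Measurable (Function.uncurry W)) {ω : Ω}
    (hF : Integrable (pathIntegrand ν W ω)) :
    Filter.Tendsto (fun n : ℕ ↦ smoothForm ν (1 / ((n : ℝ) + 1)) W ω) Filter.atTop
      (nhds (∫ ξ, pathIntegrand ν W ω ξ).re) := by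
  have e : (∫ ξ, pathIntegrand ν W ω ξ).re = ∫ ξ, (pathIntegrand ν W ω ξ).re := by
    rw [← RCLike.re_eq_complex_re, ← integral_re hF]
  rw [e]
  simp_rw [fun n : ℕ ↦ smoothForm_eq_integral (W := W) ν hm
    (show (0 : ℝ) < 1 / ((n : ℝ) + 1) by positivity) ω]
  have hm2 : Measurable (pathIntegrand ν W ω) :=
    (measurable_uncurry_pathIntegrand ν hm).of_uncurry_left
  refine tendsto_integral_of_dominated_convergence (fun ξ ↦ ‖pathIntegrand ν W ω ξ‖)
    (fun n ↦ Measurable.aestronglyMeasurable ?_) hF.norm (fun n ↦ ae_of_all _ fun ξ ↦ ?_)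
    (ae_of_all _ fun ξ ↦ ?_)
  · have hre : Measurable fun ξ ↦ (pathIntegrand ν W ω ξ).re := Complex.measurable_re.comp hm2
    fun_prop
  · rw [norm_mul]
    refine (mul_le_of_le_one_left (norm_nonneg _) ?_).trans (Complex.abs_re_le_norm _)
    rw [Real.norm_of_nonneg (by positivity), Real.exp_le_one_iff, neg_mul, neg_nonpos]
    positivity
  · have h := (tendsto_one_div_add_atTop_nhds_zero_nat (𝕜 := ℝ))
    have h2 : Filter.Tendsto (fun n : ℕ ↦ Real.exp (-(1 / ((n : ℝ) + 1)) * ξ ^ 2)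
        * (pathIntegrand ν W ω ξ).re) Filter.atTop
        (nhds (Real.exp (-0 * ξ ^ 2) * (pathIntegrand ν W ω ξ).re)) :=
      ((Real.continuous_exp.tendsto _).comp (h.neg.mul_const _)).mul_const _
    simpa using h2

end Limits

/-- The integrand at `-ξ` is the conjugate of the integrand at `ξ`, so the trilinear form is real. -/
theorem im_integral_pathIntegrand {Ω : Type*} (ν : Measure ℝ≥0)
    (W : ℝ≥0 → Ω → ℝ) (ω : Ω) : (∫ ξ, pathIntegrand ν W ω ξ).im = 0 := by
  have h1 : ∫ ξ, pathIntegrand ν W ω (-ξ) = ∫ ξ, pathIntegrand ν W ω ξ :=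
    integral_neg_eq_self _ _
  have h2 (ξ : ℝ) : pathIntegrand ν W ω (-ξ) = starRingEnd ℂ (pathIntegrand ν W ω ξ) := by
    simp only [pathIntegrand, map_mul, ← pathFourier_neg]
    ring_nf
  simp_rw [h2] at h1
  rw [integral_conj] at h1
  exact Complex.conj_eq_iff_im.1 h1

/-! ### A lower bound uniform in the Frostman measure -/

section Constants

theorem exists_exp_neg_mul_sq_mul_le {a B d : ℝ} (ha : 0 < a) (hB : 0 ≤ B) (hd : 0 < d) :
    ∃ κ : ℝ, Real.exp (-(a * κ ^ 2)) * B ≤ d := by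
  refine ⟨√(B / (d * a)), ?_⟩
  rw [Real.sq_sqrt (by positivity), show a * (B / (d * a)) = B / d by field_simp, Real.exp_neg,
    inv_mul_le_iff₀ (Real.exp_pos _)]
  have h := Real.add_one_le_exp (B / d)
  calc B = B / d * d := by field_simp
    _ ≤ Real.exp (B / d) * d := by gcongr; linarith

/-- A radius at which Frostman measures of all exponents `s ≥ 1 / 3` give balls mass at most `1 / 6`. -/
theorem exists_radius_mul_rpow_le (C : ℝ) :
    ∃ r : ℝ, 0 < r ∧ ∀ s : ℝ, 1 / 3 ≤ s → C * (2 * r) ^ s ≤ 1 / 6 := by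
  set q : ℝ := (6 * max C 1)⁻¹ with hq
  have hm : 1 ≤ max C 1 := le_max_right _ _
  have hq0 : 0 < q := by positivity
  have hq1 : q ≤ 1 := inv_le_one_of_one_le₀ (by linarith)
  refine ⟨q ^ 3 / 2, by positivity, fun s hs ↦ ?_⟩
  have h1 : (2 * (q ^ 3 / 2)) ^ s ≤ q := by
    rw [mul_div_cancel₀ _ two_ne_zero]
    refine (Real.rpow_le_rpow_of_exponent_ge (by positivity) (pow_le_one₀ hq0.le hq1) hs).trans_eq ?_
    rw [← Real.rpow_natCast_mul hq0.le]
    norm_num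
  calc C * (2 * (q ^ 3 / 2)) ^ s ≤ max C 1 * q := by gcongr; exact le_max_left _ _
    _ = 1 / 6 := by rw [hq]; field_simp

end Constants

section Core

/-- The result for a version of Brownian motion with continuous paths, and with times in `ℝ≥0`. The
event is that infinitely many of the damped forms exceed `c₁ / 2`; on it the trilinear form, whose
double dominates the limit superior of the damped forms, is at least `c₁ / 4`. -/
theorem exists_event_of_continuous (C ε : ℝ) (hC : 0 < C) (hε : 0 < ε) :
    ∃ c : ℝ, 0 < c ∧ ∀ (s : ℝ), 1 / 3 + ε / 2 < s → s ≤ 1 →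
      ∀ (ν : Measure ℝ≥0) [IsProbabilityMeasure ν],
        (∀ (t : ℝ≥0) (ρ : ℝ), 0 ≤ ρ → ν.real (Metric.closedBall t ρ) ≤ C * (2 * ρ) ^ s) →
        (∀ᵐ t ∂ν, t ≤ 1) →
      ∀ (Ω : Type*) [MeasurableSpace Ω] (P : Measure Ω) (W : ℝ≥0 → Ω → ℝ),
        IsPreBrownianReal W P → Measurable (Function.uncurry W) → (∀ ω, Continuous (W · ω)) →
        (∀ᵐ ω ∂P, Integrable (pathIntegrand ν W ω)) ∧
        ∃ A : Set Ω, MeasurableSet A ∧ c ≤ P.real A ∧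
          ∀ ω ∈ A, 0 < (∫ ξ, pathIntegrand ν W ω ξ).re ∧
            HasThreeAP (ν.map (W · ω)).support := by
  obtain ⟨r, hr, hrC⟩ := exists_radius_mul_rpow_le C
  set c₂ : ℝ := √(Real.pi / (1 + 32 * Real.pi ^ 2)) with hc₂
  have hc₂0 : 0 < c₂ := by positivity
  obtain ⟨κ, hκ⟩ := exists_exp_neg_mul_sq_mul_le (a := 4 / 3 * Real.pi ^ 2 * r)
    (B := √(Real.pi / (4 * Real.pi ^ 2 * r))) (d := c₂ / 2) (by positivity) (by positivity)
    (by positivity)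
  -- the decay exponent `β` is admissible as `β ≤ 6 * s`, and `β > 2` makes the weight integrable
  set β : ℝ := 2 + 3 * ε with hβ
  set H : ENNReal := 4 * (ENNReal.ofReal (sixthMomentConst C β) * weightIntegral β ^ 2) with hH
  have hHtop : H ≠ ⊤ := by
    have := (weightIntegral_lt_top (β := β) (by linarith)).ne
    exact ENNReal.mul_ne_top (by norm_num)
      (ENNReal.mul_ne_top ENNReal.ofReal_ne_top (ENNReal.pow_ne_top this))
  -- the summand `1` only makes the bound positive
  set M : ℝ := 4 * H.toReal + 1 with hM
  have hM0 : 0 < M := by positivity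
  set c₁ : ℝ := c₂ / 2 / 2 with hc₁
  have hc₁0 : 0 < c₁ := by positivity
  refine ⟨c₁ ^ 2 / (4 * M), by positivity, ?_⟩
  intro s hs hs1 ν _ hν hν1 Ω _ P W hW hm hcont
  have := hW.isGaussianProcess.isProbabilityMeasure
  have hsec : ∫⁻ ω, (∫⁻ ξ, ‖pathIntegrand ν W ω ξ‖ₑ) ^ 2 ∂P ≤ H :=
    lintegral_sq_lintegral_pathIntegrand_le ν hW hm hC.le hs1 (by positivity) (by linarith) hν
  have hFm := measurable_uncurry_pathIntegrand ν hm
  have hLm : Measurable fun ω ↦ ∫⁻ ξ, ‖pathIntegrand ν W ω ξ‖ₑ :=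
    Measurable.lintegral_prod_right' (f := fun p : Ω × ℝ ↦ ‖pathIntegrand ν W p.1 p.2‖ₑ) hFm.enorm
  have hfin : ∀ᵐ ω ∂P, ∫⁻ ξ, ‖pathIntegrand ν W ω ξ‖ₑ < ⊤ := by
    filter_upwards [ae_lt_top (hLm.pow_const 2) (hsec.trans_lt hHtop.lt_top).ne] with ω hω
    by_contra h
    rw [not_lt_top_iff] at h
    simp [h] at hω
  have hint (ω : Ω) (h : ∫⁻ ξ, ‖pathIntegrand ν W ω ξ‖ₑ < ⊤) :
      Integrable (pathIntegrand ν W ω) :=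
    ⟨hFm.of_uncurry_left.aestronglyMeasurable, h⟩
  refine ⟨hfin.mono hint, ?_⟩
  have hZm (n : ℕ) : Measurable (dampedForm ν (1 / ((n : ℝ) + 1)) κ W) :=
    (stronglyMeasurable_dampedForm ν hm _ κ).measurable
  have hb (n : ℕ) : (0 : ℝ) < 1 / ((n : ℝ) + 1) := by positivity
  have hb1 (n : ℕ) : 1 / ((n : ℝ) + 1) ≤ 1 := by
    rw [div_le_one (by positivity)]
    linarith [n.cast_nonneg (α := ℝ)]
  have hA (n : ℕ) : c₁ ^ 2 / (4 * M)
      ≤ P.real {ω | c₁ / 2 < dampedForm ν (1 / ((n : ℝ) + 1)) κ W ω} := by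
    refine le_measureReal_lt_of_secondMoment_le hc₁0 hM0 (hZm n) (dampedForm_nonneg ν _ κ)
      (integrable_dampedForm ν hm (hb n) κ) ?_ ?_
    · refine le_integral_dampedForm ν hW hm hν1 (hb n) (hb1 n) κ hr
        (fun t ↦ (hν t r hr.le).trans (hrC s (by linarith))) (by positivity) ?_
      linarith
    · calc ∫⁻ ω, ENNReal.ofReal (dampedForm ν (1 / ((n : ℝ) + 1)) κ W ω) ^ 2 ∂P
          ≤ ∫⁻ ω, 4 * (∫⁻ ξ, ‖pathIntegrand ν W ω ξ‖ₑ) ^ 2 ∂P := by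
            refine lintegral_mono fun ω ↦ ?_
            have h : ENNReal.ofReal (dampedForm ν (1 / ((n : ℝ) + 1)) κ W ω)
                ≤ 2 * ∫⁻ ξ, ‖pathIntegrand ν W ω ξ‖ₑ := by
              refine (ENNReal.ofReal_le_ofReal (dampedForm_le_two_mul ν hm (hb n) κ ω)).trans ?_
              rw [ENNReal.ofReal_mul zero_le_two, ENNReal.ofReal_ofNat]
              gcongr
              exact ofReal_smoothForm_le ν hm (hb n) ω
            refine (pow_le_pow_left₀ zero_le h 2).trans_eq ?_
            ring
        _ ≤ 4 * H := by
            rw [lintegral_const_mul' _ _ (by norm_num)]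
            gcongr
        _ ≤ ENNReal.ofReal M := by
            rw [hM, ENNReal.ofReal_add (by positivity) zero_le_one,
              ENNReal.ofReal_mul (by norm_num), ENNReal.ofReal_ofNat, ENNReal.ofReal_toReal hHtop]
            exact le_self_add
  have hAm (n : ℕ) : MeasurableSet {ω | c₁ / 2 < dampedForm ν (1 / ((n : ℝ) + 1)) κ W ω} :=
    measurableSet_lt measurable_const (hZm n)
  have hlim := le_measureReal_frequently_mem hAm hA
  have hGm : MeasurableSet {ω | ∫⁻ ξ, ‖pathIntegrand ν W ω ξ‖ₑ < ⊤} :=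
    measurableSet_lt hLm measurable_const
  refine ⟨{ω | ∃ᶠ n : ℕ in Filter.atTop, c₁ / 2 < dampedForm ν (1 / ((n : ℝ) + 1)) κ W ω}
    ∩ {ω | ∫⁻ ξ, ‖pathIntegrand ν W ω ξ‖ₑ < ⊤}, ?_, ?_, ?_⟩
  · refine MeasurableSet.inter ?_ hGm
    exact measurableSet_frequently_mem hAm
  · refine hlim.trans_eq (measureReal_congr ?_)
    filter_upwards [hfin] with ω hω
    exact propext ⟨fun h ↦ ⟨h, hω⟩, fun h ↦ h.1⟩
  · rintro ω ⟨hfr, hω⟩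
    have hF := hint ω hω
    have hcω := hcont ω
    constructor
    · have h := tendsto_smoothForm ν hm hF
      have hge : c₁ / 4 ≤ (∫ ξ, pathIntegrand ν W ω ξ).re := by
        by_contra hlt
        push Not at hlt
        obtain ⟨n, h1, h2⟩ := (hfr.and_eventually (h.eventually_lt_const hlt)).exists
        have h3 := dampedForm_le_two_mul ν hm (hb n) κ ω
        linarith
      exact lt_of_lt_of_le (by positivity) hge
    · refine exists_progression_of_frequently_lt_dampedForm ν hm hcω hν1
        Measure.isClosed_support ?_ (half_pos hc₁0)
        (M := (∫⁻ ξ, ‖pathIntegrand ν W ω ξ‖ₑ).toReal) ENNReal.toReal_nonneg (fun n ↦ ?_) hfr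
      · exact ae_of_ae_map hcω.aemeasurable Measure.support_mem_ae
      · exact (ENNReal.ofReal_le_iff_le_toReal (ne_of_lt hω)).1 (ofReal_smoothForm_le ν hm (hb n) ω)

end Core

/-! ### Transfer to the path image of a Brownian motion -/

section Modification

variable {Ω : Type*} {mΩ : MeasurableSpace Ω} {P : Measure Ω} {W : ℝ≥0 → Ω → ℝ}

/-- A Brownian motion agrees almost surely, at all times at once, with a jointly measurable process
all of whose paths are continuous. -/
theorem exists_continuous_modification (hW : IsBrownianReal W P) :
    ∃ W' : ℝ≥0 → Ω → ℝ, IsPreBrownianReal W' P ∧ Measurable (Function.uncurry W') ∧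
      (∀ ω, Continuous (W' · ω)) ∧ ∀ᵐ ω ∂P, ∀ t, W' t ω = W t ω := by
  classical
  set d := TopologicalSpace.denseSeq ℝ≥0
  have hgood : ∀ᵐ ω ∂P, Continuous (W · ω) ∧ ∀ n, W (d n) ω = (hW.aemeasurable (d n)).mk _ ω :=
    hW.cont.and (ae_all_iff.2 fun n ↦ (hW.aemeasurable (d n)).ae_eq_mk)
  obtain ⟨N, hsub, hNm, hN0⟩ := exists_measurable_superset_of_null (ae_iff.1 hgood)
  have hmem {ω : Ω} (h : ω ∉ N) :
      Continuous (W · ω) ∧ ∀ n, W (d n) ω = (hW.aemeasurable (d n)).mk _ ω := by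
    by_contra hn
    exact h (hsub hn)
  set W' : ℝ≥0 → Ω → ℝ := fun t ↦ N.piecewise (0 : Ω → ℝ) (W t) with hW'
  have hcont (ω : Ω) : Continuous (W' · ω) := by
    by_cases h : ω ∈ N
    · simp only [hW', Set.piecewise_eq_of_mem _ _ _ h]
      exact continuous_const
    · simp only [hW', Set.piecewise_eq_of_notMem _ _ _ h]
      exact (hmem h).1
  have hae : ∀ᵐ ω ∂P, ∀ t, W' t ω = W t ω := by
    filter_upwards [measure_eq_zero_iff_ae_notMem.1 hN0] with ω hω t
    simp only [hW', Set.piecewise_eq_of_notMem _ _ _ hω]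
  have hd (n : ℕ) : Measurable (W' (d n)) := by
    have e : W' (d n) = N.piecewise (0 : Ω → ℝ) ((hW.aemeasurable (d n)).mk _) := by
      funext ω
      by_cases h : ω ∈ N
      · simp only [hW', Set.piecewise_eq_of_mem _ _ _ h]
      · simp only [hW', Set.piecewise_eq_of_notMem _ _ _ h]
        exact (hmem h).2 n
    rw [e]
    exact Measurable.piecewise hNm measurable_const (hW.aemeasurable (d n)).measurable_mk
  have hmeas (t : ℝ≥0) : Measurable (W' t) := by
    obtain ⟨u, hu, hut⟩ := mem_closure_iff_seq_limit.1
      (TopologicalSpace.denseRange_denseSeq ℝ≥0 t)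
    refine measurable_of_tendsto_metrizable (f := fun k ↦ W' (u k)) (fun k ↦ ?_) ?_
    · obtain ⟨n, hn⟩ := hu k
      rw [← hn]
      exact hd n
    · exact tendsto_pi_nhds.2 fun ω ↦ ((hcont ω).tendsto t).comp hut
  refine ⟨W', hW.toIsPreBrownianReal.congr fun t ↦ ?_,
    measurable_uncurry_of_continuous_of_measurable hcont hmeas, hcont, hae⟩
  filter_upwards [hae] with ω hω using (hω t).symm

end Modification

section Transfer

/-- The times are moved from `ℝ` to `ℝ≥0` by `Real.toNNReal`, which is the identity on `[0, 1]`. -/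
theorem IsFrostman.real_map_toNNReal_closedBall_le {θ : Measure ℝ} {s C : ℝ}
    (hθ : IsFrostman θ s C) (t : ℝ≥0) (ρ : ℝ) (hρ : 0 ≤ ρ) :
    (θ.map Real.toNNReal).real (Metric.closedBall t ρ) ≤ C * (2 * ρ) ^ s := by
  have := hθ.isProbabilityMeasure
  rw [map_measureReal_apply measurable_real_toNNReal Metric.isClosed_closedBall.measurableSet]
  have hsub : Real.toNNReal ⁻¹' Metric.closedBall t ρ
      ⊆ Set.Icc ((t : ℝ) - ρ) (t + ρ) ∪ (Set.Icc 0 1)ᶜ := by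
    intro x hx
    by_cases h0 : x ∈ Set.Icc (0 : ℝ) 1
    · left
      rw [Set.mem_preimage, Metric.mem_closedBall, NNReal.dist_eq, Real.coe_toNNReal _ h0.1,
        abs_le] at hx
      constructor <;> linarith [hx.1, hx.2]
    · exact Or.inr h0
  have h1 := measureReal_mono (μ := θ) hsub
  have h2 := measureReal_union_le (μ := θ) (Set.Icc ((t : ℝ) - ρ) (t + ρ)) (Set.Icc 0 1)ᶜ
  have h3 : θ.real (Set.Icc 0 1)ᶜ = 0 := by rw [measureReal_def, hθ.compl_Icc]; rfl
  have h4 := hθ.measure_Icc_le ((t : ℝ) - ρ) (t + ρ) (by linarith)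
  rw [show (t : ℝ) + ρ - (t - ρ) = 2 * ρ by ring] at h4
  linarith

theorem IsFrostman.ae_map_toNNReal_le_one {θ : Measure ℝ} {s C : ℝ} (hθ : IsFrostman θ s C) :
    ∀ᵐ t ∂(θ.map Real.toNNReal), t ≤ 1 := by
  rw [ae_map_iff measurable_real_toNNReal.aemeasurable measurableSet_Iic]
  filter_upwards [measure_eq_zero_iff_ae_notMem.1 hθ.compl_Icc] with x hx
  rw [Set.notMem_compl_iff] at hx
  rw [Real.toNNReal_le_one]
  exact hx.2

variable {Ω : Type*} {W : ℝ≥0 → Ω → ℝ}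

theorem pathImage_eq_map (θ : Measure ℝ) {ω : Ω} (hc : Continuous (W · ω)) :
    pathImage θ W ω = (θ.map Real.toNNReal).map (W · ω) := by
  rw [Measure.map_map hc.measurable measurable_real_toNNReal]
  rfl

theorem fourierMeasure_map (ν : Measure ℝ≥0) {ω : Ω} (hc : Continuous (W · ω)) (ξ : ℝ) :
    fourierMeasure (ν.map (W · ω)) ξ = pathFourier ν W ω ξ := by
  unfold fourierMeasure pathFourier
  rw [integral_map hc.aemeasurable (Continuous.aestronglyMeasurable (by fun_prop))]
  refine integral_congr_ae (ae_of_all _ fun t ↦ ?_)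
  simp only
  congr 1
  push_cast
  ring

theorem lambdaIntegrand_pathImage (θ : Measure ℝ) {ω : Ω} (hc : Continuous (W · ω)) :
    lambdaIntegrand (pathImage θ W ω) (pathImage θ W ω) (pathImage θ W ω)
      = pathIntegrand (θ.map Real.toNNReal) W ω := by
  funext ξ
  rw [pathImage_eq_map θ hc, lambdaIntegrand, fourierMeasure_map _ hc, fourierMeasure_map _ hc]
  rfl

theorem pathImage_congr (θ : Measure ℝ) {W' : ℝ≥0 → Ω → ℝ} {ω : Ω} (h : ∀ t, W' t ω = W t ω) :
    pathImage θ W ω = pathImage θ W' ω := by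
  unfold pathImage
  simp_rw [h]

theorem Lambda_pathImage_pos_iff (θ : Measure ℝ) {ω : Ω} (hc : Continuous (W · ω)) :
    0 < Lambda (pathImage θ W ω) (pathImage θ W ω) (pathImage θ W ω)
      ↔ 0 < (∫ ξ, pathIntegrand (θ.map Real.toNNReal) W ω ξ).re := by
  rw [Lambda, lambdaIntegrand_pathImage θ hc, Complex.lt_def]
  simp [im_integral_pathIntegrand]

end Transfer


end BrownianAP

/-- `0 < Lambda _ _ _` is the order of `ℂ`: the number is real and positive. -/
theorem proposition8p3 (C₀ ε : ℝ) (hC₀ : 0 < C₀) (hε : 0 < ε) :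
    ∃ c : ℝ, 0 < c ∧
      ∀ (α : ℝ), 0 < α → α < 1 → 2 / 3 + ε < α →
      ∀ (θ : Measure ℝ), BrownianAP.IsFrostman θ (α / 2) C₀ →
      ∀ (Ω : Type*) [MeasurableSpace Ω] (P : Measure Ω) [IsProbabilityMeasure P]
        (W : ℝ≥0 → Ω → ℝ), IsBrownianReal W P →
      ∀ (μ : Ω → Measure ℝ), μ = BrownianAP.pathImage θ W →
        -- the integral defining `Λ(μ, μ, μ)` converges absolutely almost surely
        (∀ᵐ ω ∂P, Integrable (BrownianAP.lambdaIntegrand (μ ω) (μ ω) (μ ω))) ∧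
        -- `Λ(μ, μ, μ) > 0` is an event of probability at least `c`
        NullMeasurableSet {ω | 0 < BrownianAP.Lambda (μ ω) (μ ω) (μ ω)} P ∧
        c ≤ P.real {ω | 0 < BrownianAP.Lambda (μ ω) (μ ω) (μ ω)} ∧
        -- with probability at least `c`, `supp μ` contains a nontrivial progression
        ∃ A : Set Ω, MeasurableSet A ∧ c ≤ P.real A ∧
          ∀ ω ∈ A, BrownianAP.HasThreeAP (μ ω).support := by
  obtain ⟨c, hc, hcore⟩ := BrownianAP.exists_event_of_continuous C₀ ε hC₀ hε
  refine ⟨c, hc, ?_⟩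
  rintro α hα0 hα1 hα θ hθ Ω _ P _ W hW μ rfl
  have := hθ.isProbabilityMeasure
  obtain ⟨W', hW', hm, hcont, hae⟩ := BrownianAP.exists_continuous_modification hW
  have hprob : IsProbabilityMeasure (θ.map Real.toNNReal) :=
    Measure.isProbabilityMeasure_map measurable_real_toNNReal.aemeasurable
  obtain ⟨hint, A, hA, hcA, hAP⟩ := hcore (α / 2) (by linarith) (by linarith)
    (θ.map Real.toNNReal) hθ.real_map_toNNReal_closedBall_le hθ.ae_map_toNNReal_le_one
    Ω P W' hW' hm hcont
  have hset : {ω | 0 < BrownianAP.Lambda (BrownianAP.pathImage θ W ω)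
        (BrownianAP.pathImage θ W ω) (BrownianAP.pathImage θ W ω)}
      =ᵐ[P] {ω | 0 < (∫ ξ, BrownianAP.pathIntegrand (θ.map Real.toNNReal) W' ω ξ).re} := by
    filter_upwards [hae] with ω hω
    refine propext ?_
    change 0 < BrownianAP.Lambda (BrownianAP.pathImage θ W ω)
        (BrownianAP.pathImage θ W ω) (BrownianAP.pathImage θ W ω) ↔
      0 < (∫ ξ, BrownianAP.pathIntegrand (θ.map Real.toNNReal) W' ω ξ).re
    rw [BrownianAP.pathImage_congr θ hω, BrownianAP.Lambda_pathImage_pos_iff θ (hcont ω)]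
  have hmeas : MeasurableSet
      {ω | 0 < (∫ ξ, BrownianAP.pathIntegrand (θ.map Real.toNNReal) W' ω ξ).re} := by
    have hsm : StronglyMeasurable
        fun ω ↦ ∫ ξ, BrownianAP.pathIntegrand (θ.map Real.toNNReal) W' ω ξ :=
      StronglyMeasurable.integral_prod_right (f := BrownianAP.pathIntegrand _ W')
        (BrownianAP.measurable_uncurry_pathIntegrand _ hm).stronglyMeasurable
    exact measurableSet_lt measurable_const (Complex.measurable_re.comp hsm.measurable)
  refine ⟨?_, hmeas.nullMeasurableSet.congr hset.symm, ?_, ?_⟩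
  · filter_upwards [hae, hint] with ω hω hi
    rw [BrownianAP.pathImage_congr θ hω, BrownianAP.lambdaIntegrand_pathImage θ (hcont ω)]
    exact hi
  · rw [measureReal_congr hset]
    exact hcA.trans (measureReal_mono fun ω hω ↦ (hAP ω hω).1)
  · obtain ⟨N, hsub, hNm, hN0⟩ := exists_measurable_superset_of_null (ae_iff.1 hae)
    refine ⟨A \ N, hA.diff hNm, ?_, fun ω hω ↦ ?_⟩
    · rw [measureReal_def, measure_sdiff_null hN0]
      exact hcA
    · have h : ∀ t, W' t ω = W t ω := by
        by_contra hn
        exact hω.2 (hsub hn)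
      rw [BrownianAP.pathImage_congr θ h, BrownianAP.pathImage_eq_map θ (hcont ω)]
      exact (hAP ω hω.1).2
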